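/- Let $n\ge 0$ and $J\subseteq[n]=\{1,\dots,n\}$, and let $S_J$ be the set of permutations $\pi$ of $[n]$ with $\pi(j)\ge j$ for $j\in J$ and $\pi(j)\le j$ for $j\notin J$. The bridge polytope $\mathsf{Br}_J\subset\mathbb R^n$ is the convex hull of the points $(\pi(1),\dots,\pi(n))$, $\pi\in S_J$. An edge of $\mathsf{Br}_J$ between $\pi$ and $\hat\pi$ is labelled $(a\,b)$, where $a\ne b$, if $\hat\pi=(a\,b)\pi$, that is, if $\pi$ and $\hat\pi$ differ by swapping the values $a$ and $b$. **Theorem.** Let $F$ be a two-dimensional face of a bridge polytope $\mathsf{Br}_J$. Then the vertices of $F$ are points $(\pi(1),\dots,\pi(n))$ with $\pi\in S_J$, every side of $F$ is an edge of $\mathsf{Br}_J$ carrying a label $(a\,b)$, and such a side has length $\sqrt2\,|a-b|$. Moreover $F$ is one of the following: 1. a right-angled quadrilateral (all angles equal to $\pi/2$) whose sides are labelled, in cyclic order, $(i\,j),(k\,l),(i\,j),(k\,l)$ for some $i<j<k<l$ (so it is a rectangle, and a square exactly when $j-i=l-k$); 2. a trapezoid with angles $\pi/3,\pi/3,2\pi/3,2\pi/3$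 whose sides are labelled, in cyclic order starting with the longer base (the side between the two angles $\pi/3$), $(i\,k),(i\,j),(j\,k),(i\,j)$ for some $i,j,k$ with $i<j<k$ or $k<j<i$; 3. a hexagon with all angles equal to $2\pi/3$ whose sides are labelled, in cyclic order, $(i\,j),(j\,k),(i\,j),(j\,k),(i\,j),(j\,k)$ for some $i<j<k$ (so it is a regular hexagon exactly when $j-i=k-j$). -/

import Mathlib

open scoped EuclideanGeometry

/-- The set `S_J` of permutations of `[n]` with a weak excedance in every position `j ∈ J` and a
weak non-excedance in every position `j ∉ J`.  The set `[n] = {1, …, n}` is modelled by `Fin n`,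
the element `i : Fin n` standing for the number `i + 1`. -/
def bridgePerms {n : ℕ} (J : Finset (Fin n)) : Set (Equiv.Perm (Fin n)) :=
  {π | (∀ j ∈ J, j ≤ π j) ∧ ∀ j ∉ J, π j ≤ j}

/-- The point `(π(1), …, π(n))` of `ℝⁿ`. -/
noncomputable def permPoint {n : ℕ} (π : Equiv.Perm (Fin n)) : EuclideanSpace ℝ (Fin n) :=
  WithLp.toLp 2 fun j => ((π j : ℕ) : ℝ) + 1

/-- The bridge polytope of `J`: the convex hull of the points `(π(1), …, π(n))`, `π ∈ S_J`. -/
noncomputable def bridgePolytope {n : ℕ} (J : Finset (Fin n)) : Set (EuclideanSpace ℝ (Fin n)) :=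
  convexHull ℝ (permPoint '' bridgePerms J)

/-- `F` is a `d`-dimensional face of the polytope `P`: a nonempty subset of `P` on which some linear
functional attains its maximum over `P`, whose affine span has dimension `d`. -/
def IsFaceOfDim {n : ℕ} (d : ℕ) (P F : Set (EuclideanSpace ℝ (Fin n))) : Prop :=
  F.Nonempty ∧ IsExposed ℝ P F ∧ Module.finrank ℝ (vectorSpan ℝ F) = d

/-- `F` is a polygon with `m` vertices `v 0, …, v (m - 1)`, all of them labelled by elements of
`S_J`, such that the edges of the bridge polytope that lie in `F` are precisely the `m` segments
joining `v t` to `v (t + 1)` (indices modulo `m`).  The side from `v t` to `v (t + 1)` has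
label `lab t = (a, b)`, that is, its two ends differ by swapping the values `a` and `b`,
and it has length `√2 |a - b|`. -/
structure IsLabelledPolygon {n : ℕ} (J : Finset (Fin n)) (F : Set (EuclideanSpace ℝ (Fin n)))
    {m : ℕ} [NeZero m] (v : Fin m → Equiv.Perm (Fin n)) (lab : Fin m → Fin n × Fin n) : Prop where
  mem : ∀ t, v t ∈ bridgePerms J
  injective : Function.Injective v
  hull : F = convexHull ℝ (Set.range fun t => permPoint (v t))
  vertices : F.extremePoints ℝ = Set.range fun t => permPoint (v t)
  sides : ∀ E, (IsFaceOfDim 1 (bridgePolytope J) E ∧ E ⊆ F) ↔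
    ∃ t, E = segment ℝ (permPoint (v t)) (permPoint (v (t + 1)))
  label_ne : ∀ t, (lab t).1 ≠ (lab t).2
  label : ∀ t, v (t + 1) = Equiv.swap (lab t).1 (lab t).2 * v t
  length : ∀ t, dist (permPoint (v t)) (permPoint (v (t + 1))) =
    √2 * |(((lab t).1 : ℕ) : ℝ) - (((lab t).2 : ℕ) : ℝ)|

/-- The angle of the polygon with vertices `v 0, …, v (m - 1)` (in cyclic order) at `v t`. -/
noncomputable def angleAt {n m : ℕ} [NeZero m] (v : Fin m → Equiv.Perm (Fin n)) (t : Fin m) : ℝ :=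
  ∠ (permPoint (v (t - 1))) (permPoint (v t)) (permPoint (v (t + 1)))

/-- `F` is a right-angled quadrilateral whose sides are labelled, in cyclic order,
`(i j), (k l), (i j), (k l)` with `i < j < k < l`. -/
def IsSquareFace {n : ℕ} (J : Finset (Fin n)) (F : Set (EuclideanSpace ℝ (Fin n))) : Prop :=
  ∃ (i j k l : Fin n) (v : Fin 4 → Equiv.Perm (Fin n)), i < j ∧ j < k ∧ k < l ∧
    IsLabelledPolygon J F v ![(i, j), (k, l), (i, j), (k, l)] ∧
    ∀ t, angleAt v t = Real.pi / 2

/-- `F` is a trapezoid with angles `π/3, π/3, 2π/3, 2π/3`, whose longer base is labelled `(i k)`,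
whose shorter base is labelled `(j k)`, and whose legs are both labelled `(i j)`, where
`i < j < k` or `k < j < i`. -/
def IsTrapezoidFace {n : ℕ} (J : Finset (Fin n)) (F : Set (EuclideanSpace ℝ (Fin n))) : Prop :=
  ∃ (i j k : Fin n) (v : Fin 4 → Equiv.Perm (Fin n)), ((i < j ∧ j < k) ∨ (k < j ∧ j < i)) ∧
    IsLabelledPolygon J F v ![(i, k), (i, j), (j, k), (i, j)] ∧
    angleAt v 0 = Real.pi / 3 ∧ angleAt v 1 = Real.pi / 3 ∧
    angleAt v 2 = 2 * Real.pi / 3 ∧ angleAt v 3 = 2 * Real.pi / 3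

/-- `F` is a hexagon with all angles `2π/3`, whose sides are labelled alternately `(i j)` and
`(j k)` with `i < j < k`. -/
def IsHexagonFace {n : ℕ} (J : Finset (Fin n)) (F : Set (EuclideanSpace ℝ (Fin n))) : Prop :=
  ∃ (i j k : Fin n) (v : Fin 6 → Equiv.Perm (Fin n)), i < j ∧ j < k ∧
    IsLabelledPolygon J F v ![(i, j), (j, k), (i, j), (j, k), (i, j), (j, k)] ∧
    ∀ t, angleAt v t = 2 * Real.pi / 3

/-! A functional with coefficients `c` exposes the face spanned by the members of `S_J` of maximal
`weight c`. The engine is the maximality property of Gelfand and Serganova (`HasDominant`): for each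
`c`, one member of `S_J` maximizes simultaneously, for all `t` and `m`, the number of positions with
coefficient at least `t` and value at least `m`. It holds for `S_J` by induction, because `S_J` is
built from the singleton `{1}` by relabelling two adjacent positions and closing under the swap of
two adjacent values (`bridgePerms_eq_union`). By Abel summation a maximizer of the weight must have
the same counts as the dominant member, so two vertices of a face differ only by rearranging values
inside the level sets of `c` (`apply_symm_eq`).

After a perturbation of `c` (`exists_generic`) the directions of the face are exactly the vectors
with zero sum over every level set, so the dimension is `n` minus the number of level sets. Hence an
edge has one level set of size two, and its ends differ by a transposition; a two-dimensional face
has either one level set of size three or two of size two.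

It remains to see which values can occur. If a position takes the values `a < b` on a face, an
intermediate value fixed at a position of another level must sit at a position strictly between `a`
and `b`, since otherwise a swap would raise the weight (`between_of_between`). With the pigeonhole
principle this makes whole intervals stable. For two level pairs it excludes crossing values
directly, and nested values after a count of upward and downward crossings
(`false_of_down_crossing`), leaving `i < j < k < l`. For a level triple every position admits the
middle value, and the same pigeonhole argument shows that at most one combination of a position with
an extreme value is forbidden. No forbidden combination leaves all six arrangements, a hexagon; one
leaves four, a trapezoid.

Lengths and angles come from inner products of swap vectors. A diagonal is never an edge: its ends
do not differ by a transposition, except for the three long diagonals of the hexagon, which no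
functional can expose. -/

/-! ### Level counts and the maximality property -/

/-- The number of positions `p` with `t ≤ c p` whose value under `y` is at least `m`. -/
noncomputable def levelCount {n : ℕ} (c : Fin n → ℝ) (y : Equiv.Perm (Fin n)) (t : ℝ) (m : ℕ) : ℕ :=
  (Finset.univ.filter fun p => t ≤ c p ∧ m ≤ (y p : ℕ)).card

theorem levelCount_succ {n : ℕ} (c : Fin n → ℝ) (y : Equiv.Perm (Fin n)) (t : ℝ) (m : Fin n) :
    levelCount c y t m = levelCount c y t (m + 1) + if t ≤ c (y.symm m) then 1 else 0 := by
  unfold levelCount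
  split_ifs with h
  · have : (Finset.univ.filter fun p => t ≤ c p ∧ (m : ℕ) ≤ (y p : ℕ)) =
        insert (y.symm m) (Finset.univ.filter fun p => t ≤ c p ∧ (m : ℕ) + 1 ≤ (y p : ℕ)) := by
      ext p
      simp only [Finset.mem_filter, Finset.mem_univ, true_and, Finset.mem_insert,
        Equiv.eq_symm_apply, Fin.ext_iff]
      constructor
      · rintro ⟨h1, h2⟩
        by_cases h3 : (y p : ℕ) = m
        · exact Or.inl h3
        · exact Or.inr ⟨h1, by omega⟩
      · rintro (h1 | ⟨h1, h2⟩)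
        · have : p = y.symm m := by rw [Equiv.eq_symm_apply]; exact Fin.ext h1
          exact ⟨this ▸ h, h1.ge⟩
        · exact ⟨h1, by omega⟩
    rw [this, Finset.card_insert_of_notMem]
    simp
  · rw [add_zero]
    congr 1
    ext p
    simp only [Finset.mem_filter, Finset.mem_univ, true_and]
    refine and_congr_right fun h1 => ⟨fun h2 => ?_, fun h2 => by omega⟩
    rcases h2.lt_or_eq with h3 | h3
    · exact h3
    · have : p = y.symm m := by rw [Equiv.eq_symm_apply]; exact Fin.ext h3.symm
      exact absurd (this ▸ h1) h

/-- The threshold `k = j + 1` is the only one that separates the values `j` and `k`. -/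
theorem levelCount_swap_mul {n : ℕ} (c : Fin n → ℝ) (y : Equiv.Perm (Fin n)) (t : ℝ) {j k : Fin n}
    (hjk : (k : ℕ) = j + 1) {m : ℕ} (hm : m ≠ k) :
    levelCount c (Equiv.swap j k * y) t m = levelCount c y t m := by
  unfold levelCount
  congr 1
  ext p
  rw [Finset.mem_filter, Finset.mem_filter, Equiv.Perm.mul_apply]
  refine and_congr_right fun _ => and_congr_right fun _ => ?_
  rcases eq_or_ne (y p) j with h | h
  · rw [h, Equiv.swap_apply_left]; omega
  rcases eq_or_ne (y p) k with h' | h'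
  · rw [h', Equiv.swap_apply_right]; omega
  · rw [Equiv.swap_apply_of_ne_of_ne h h']

/-- The maximality property of Gelfand and Serganova: for every weak ordering of the positions,
one member of `S` dominates all members of `S`. -/
def HasDominant {n : ℕ} (S : Set (Equiv.Perm (Fin n))) : Prop :=
  ∀ c : Fin n → ℝ, ∃ x ∈ S, ∀ y ∈ S, ∀ t m, levelCount c y t m ≤ levelCount c x t m

/-- Swapping adjacent values affects only the counts at the threshold `k`. There the better of `x`
and its swap is the one that puts `k` on the position with the larger coefficient, and it dominates
the enlarged set. -/
theorem HasDominant.union_swap {n : ℕ} {S : Set (Equiv.Perm (Fin n))} (hS : HasDominant S)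
    {j k : Fin n} (hjk : (k : ℕ) = j + 1) :
    HasDominant {π | π ∈ S ∨ Equiv.swap j k * π ∈ S} := by
  intro c
  obtain ⟨x, hx, hdom⟩ := hS c
  have inv : ∀ z : Equiv.Perm (Fin n), Equiv.swap j k * (Equiv.swap j k * z) = z :=
    fun z => by rw [← mul_assoc, Equiv.swap_mul_self, one_mul]
  have key : ∀ z : Equiv.Perm (Fin n), (Equiv.swap j k * z).symm j = z.symm k := fun z => by
    rw [Equiv.symm_apply_eq]; simp
  have cnt : ∀ (z : Equiv.Perm (Fin n)) t,
      levelCount c (Equiv.swap j k * z) t k + (if t ≤ c (z.symm k) then 1 else 0)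
        = levelCount c z t k + (if t ≤ c (z.symm j) then 1 else 0) := fun z t => by
    have h1 := levelCount_succ c z t j
    have h2 := levelCount_succ c (Equiv.swap j k * z) t j
    rw [key, levelCount_swap_mul c z t hjk (by omega), ← hjk] at h2
    rw [← hjk] at h1
    omega
  -- A swapped member can beat `x` at the threshold `k` by at most one, and only if `t` separates
  -- the coefficients at which `x` has `j` and `k`. This uses the dominance of `x` at `j`, `k` and
  -- `k + 1`.
  have base : ∀ y ∈ S, ∀ t, levelCount c (Equiv.swap j k * y) t k ≤
      levelCount c x t k + (if t ≤ c (x.symm k) then 0 else if t ≤ c (x.symm j) then 1 else 0) := by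
    intro y hy t
    have h0 := cnt y t
    have h1 := levelCount_succ c y t j
    have h2 := levelCount_succ c y t k
    have h3 := levelCount_succ c x t j
    have h4 := levelCount_succ c x t k
    have h5 := hdom y hy t j
    have h6 := hdom y hy t k
    have h7 := hdom y hy t (k + 1)
    rw [← hjk] at h1 h3
    split_ifs at * <;> omega
  have main : ∃ x' ∈ {π | π ∈ S ∨ Equiv.swap j k * π ∈ S}, ∀ y ∈ S, ∀ t m,
      levelCount c y t m ≤ levelCount c x' t m ∧
      levelCount c (Equiv.swap j k * y) t m ≤ levelCount c x' t m := by
    by_cases hc : c (x.symm k) < c (x.symm j)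
    · refine ⟨Equiv.swap j k * x, Or.inr (by rwa [inv]), fun y hy t m => ?_⟩
      rcases eq_or_ne m k with rfl | hm
      · have h0 := cnt x t
        have h1 := base y hy t
        have h2 := hdom y hy t k
        have h3 : t ≤ c (x.symm k) → t ≤ c (x.symm j) := fun h => h.trans hc.le
        split_ifs at * <;> first | omega | tauto
      · rw [levelCount_swap_mul c x t hjk hm, levelCount_swap_mul c y t hjk hm]
        exact ⟨hdom y hy t m, hdom y hy t m⟩
    · refine ⟨x, Or.inl hx, fun y hy t m => ⟨hdom y hy t m, ?_⟩⟩
      rcases eq_or_ne m k with rfl | hm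
      · have h1 := base y hy t
        have h3 : t ≤ c (x.symm j) → t ≤ c (x.symm k) := fun h => h.trans (not_lt.1 hc)
        split_ifs at * <;> first | omega | tauto
      · rw [levelCount_swap_mul c y t hjk hm]
        exact hdom y hy t m
  obtain ⟨x', hx', h'⟩ := main
  refine ⟨x', hx', fun y hy t m => ?_⟩
  rcases hy with hy | hy
  · exact (h' y hy t m).1
  · simpa only [inv] using (h' _ hy t m).2

theorem levelCount_mul {n : ℕ} (c : Fin n → ℝ) (y s : Equiv.Perm (Fin n)) (t : ℝ) (m : ℕ) :
    levelCount c (y * s) t m = levelCount (c ∘ s.symm) y t m := by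
  unfold levelCount
  refine Finset.card_bij' (fun p _ => s p) (fun p _ => s.symm p) (fun p hp => ?_) (fun p hp => ?_)
    (fun p _ => s.symm_apply_apply p) (fun p _ => s.apply_symm_apply p) <;>
  · rw [Finset.mem_filter] at hp ⊢
    simpa using hp.2

theorem HasDominant.comp {n : ℕ} {S : Set (Equiv.Perm (Fin n))} (hS : HasDominant S)
    (s : Equiv.Perm (Fin n)) : HasDominant {π | π * s ∈ S} := by
  intro c
  obtain ⟨x, hx, hdom⟩ := hS (c ∘ s)
  have e : ∀ z t m, levelCount c (z * s⁻¹) t m = levelCount (c ∘ s) z t m := fun z t m =>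
    levelCount_mul c z s⁻¹ t m
  refine ⟨x * s⁻¹, by simpa using hx, fun y hy t m => ?_⟩
  rw [e, ← mul_inv_cancel_right y s, e]
  exact hdom _ hy t m

/-! ### The maximality property of `S_J` -/

/-- Position `s` may carry the value `v`. -/
def Allowed {n : ℕ} (J : Finset (Fin n)) (s v : Fin n) : Prop :=
  (s ∈ J → s ≤ v) ∧ (s ∉ J → v ≤ s)

theorem mem_bridgePerms_iff {n : ℕ} {J : Finset (Fin n)} {π : Equiv.Perm (Fin n)} :
    π ∈ bridgePerms J ↔ ∀ s, Allowed J s (π s) :=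
  ⟨fun h s => ⟨h.1 s, h.2 s⟩, fun h => ⟨fun s => (h s).1, fun s => (h s).2⟩⟩

/-- If all larger positions are already known to be fixed, a position of `J` cannot move up: its
value would be a fixed position of `J`, against injectivity. Positions outside `J` are handled
dually from below. -/
theorem eq_one_of_isUpperSet {n : ℕ} {J : Finset (Fin n)} (hJ : IsUpperSet (J : Set (Fin n)))
    {π : Equiv.Perm (Fin n)} (hπ : π ∈ bridgePerms J) : π = 1 := by
  ext1 j
  rw [Equiv.Perm.one_apply]
  by_cases hj : j ∈ J
  · induction j using WellFoundedGT.induction with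
    | ind j ih =>
      by_contra hne
      have hlt : j < π j := lt_of_le_of_ne (hπ.1 j hj) (Ne.symm hne)
      exact hne (π.injective (ih _ hlt (hJ hlt.le hj)))
  · induction j using WellFoundedLT.induction with
    | ind j ih =>
      by_contra hne
      have hlt : π j < j := lt_of_le_of_ne (hπ.2 j hj) hne
      exact hne (π.injective (ih _ hlt fun h => hj (hJ hlt.le h)))

theorem exists_adjacent_of_not_isUpperSet {n : ℕ} {J : Finset (Fin n)}
    (hJ : ¬ IsUpperSet (J : Set (Fin n))) :
    ∃ j k : Fin n, (k : ℕ) = j + 1 ∧ j ∈ J ∧ k ∉ J := by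
  by_contra hcon
  push Not at hcon
  refine hJ fun a b hab ha => ?_
  obtain ⟨d, hd⟩ : ∃ d, (b : ℕ) = a + d := ⟨b - a, by have := Fin.le_def.1 hab; omega⟩
  induction d generalizing b with
  | zero => have : b = a := Fin.ext hd
            rwa [this]
  | succ d ih =>
    have hlt : (a : ℕ) + d < n := by omega
    exact hcon ⟨a + d, hlt⟩ b (by rw [hd]; rfl)
      (ih (b := ⟨a + d, hlt⟩) (Fin.le_def.2 (Nat.le_add_right _ _)) rfl)

/-- The set on the right before closing under the swap consists of the `π` with `k ≤ π j` and `π k ≤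
j` that obey `J` elsewhere. A member of `S_J` violates these bounds only if `π j = j` or `π k = k`,
and exchanging the values `j` and `k` repairs that. -/
theorem bridgePerms_eq_union {n : ℕ} {J : Finset (Fin n)} {j k : Fin n} (hjk : (k : ℕ) = j + 1)
    (hj : j ∈ J) (hk : k ∉ J) :
    bridgePerms J = {π | π ∈ {π | π * Equiv.swap j k ∈
        bridgePerms (J.map (Equiv.swap j k).toEmbedding)} ∨
      Equiv.swap j k * π ∈ {π | π * Equiv.swap j k ∈
        bridgePerms (J.map (Equiv.swap j k).toEmbedding)}} := by
  have hne : j ≠ k := fun h => by rw [h] at hjk; omega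
  have aux : ∀ π : Equiv.Perm (Fin n),
      π * Equiv.swap j k ∈ bridgePerms (J.map (Equiv.swap j k).toEmbedding) ↔
      (∀ s, s ≠ j → s ≠ k → Allowed J s (π s)) ∧ k ≤ π j ∧ π k ≤ j := by
    intro π
    rw [mem_bridgePerms_iff]
    have hm : ∀ s, s ∈ J.map (Equiv.swap j k).toEmbedding ↔ Equiv.swap j k s ∈ J := by
      intro s; rw [Finset.mem_map_equiv, Equiv.symm_swap]
    constructor
    · intro h
      refine ⟨fun s h1 h2 => ?_, ?_, ?_⟩
      · have := h s
        simpa only [Allowed, hm, Equiv.Perm.mul_apply, Equiv.swap_apply_of_ne_of_ne h1 h2] using this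
      · have := (h k).1
        simpa [hm, hj] using this
      · have := (h j).2
        simpa [hm, hk] using this
    · rintro ⟨h, h1, h2⟩ s
      rcases eq_or_ne s j with rfl | h3
      · simpa [Allowed, hm, hk] using h2
      rcases eq_or_ne s k with rfl | h4
      · simpa [Allowed, hm, hj] using h1
      · simpa only [Allowed, hm, Equiv.Perm.mul_apply, Equiv.swap_apply_of_ne_of_ne h3 h4]
          using h s h3 h4
  -- A position other than `j` and `k` compares in the same way with the two consecutive values.
  have swapAllowed : ∀ s, s ≠ j → s ≠ k → ∀ v, Allowed J s (Equiv.swap j k v) ↔ Allowed J s v := by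
    intro s h1 h2 v
    have h1' : (s : ℕ) ≠ j := fun h => h1 (Fin.ext h)
    have h2' : (s : ℕ) ≠ k := fun h => h2 (Fin.ext h)
    rcases eq_or_ne v j with rfl | h3
    · rw [Equiv.swap_apply_left]; simp only [Allowed, Fin.le_def]
      constructor <;> rintro ⟨u1, u2⟩ <;>
        exact ⟨fun u => by have := u1 u; omega, fun u => by have := u2 u; omega⟩
    rcases eq_or_ne v k with rfl | h4
    · rw [Equiv.swap_apply_right]; simp only [Allowed, Fin.le_def]
      constructor <;> rintro ⟨u1, u2⟩ <;>
        exact ⟨fun u => by have := u1 u; omega, fun u => by have := u2 u; omega⟩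
    · rw [Equiv.swap_apply_of_ne_of_ne h3 h4]
  have rhs : ∀ π : Equiv.Perm (Fin n),
      (∀ s, s ≠ j → s ≠ k → Allowed J s ((Equiv.swap j k * π) s)) ↔
      (∀ s, s ≠ j → s ≠ k → Allowed J s (π s)) := fun π =>
    forall_congr' fun s => forall_congr' fun h1 => forall_congr' fun h2 => swapAllowed s h1 h2 _
  have hsw : ∀ v : Fin n, ((v = j ∧ Equiv.swap j k v = k) ∨ (v = k ∧ Equiv.swap j k v = j) ∨
      (v ≠ j ∧ v ≠ k ∧ Equiv.swap j k v = v)) := by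
    intro v
    rcases eq_or_ne v j with rfl | h3
    · simp
    rcases eq_or_ne v k with rfl | h4
    · simp
    · exact Or.inr (Or.inr ⟨h3, h4, Equiv.swap_apply_of_ne_of_ne h3 h4⟩)
  ext π
  simp only [Set.mem_ofPred_eq, aux, rhs, ← and_or_left]
  rw [mem_bridgePerms_iff]
  have hπ : π j ≠ π k := fun h => hne (π.injective h)
  constructor
  · intro h
    refine ⟨fun s _ _ => h s, ?_⟩
    have h1 := (h j).1 hj
    have h2 := (h k).2 hk
    simp only [Equiv.Perm.mul_apply]
    rcases hsw (π j) with ⟨a, b⟩ | ⟨a, b⟩ | ⟨a, a', b⟩ <;>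
    rcases hsw (π k) with ⟨d, e⟩ | ⟨d, e⟩ | ⟨d, d', e⟩ <;>
    rw [b, e] <;> simp only [Fin.le_def, Fin.ext_iff, ne_eq] at * <;> omega
  · rintro ⟨h, h'⟩ s
    rcases eq_or_ne s j with rfl | h3
    · refine ⟨fun _ => ?_, fun u => absurd hj u⟩
      simp only [Equiv.Perm.mul_apply] at h'
      rcases hsw (π s) with ⟨a, b⟩ | ⟨a, b⟩ | ⟨a, a', b⟩ <;> rw [b] at h' <;>
        simp only [Fin.le_def, Fin.ext_iff, ne_eq] at * <;> omega
    rcases eq_or_ne s k with rfl | h4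
    · refine ⟨fun u => absurd u hk, fun _ => ?_⟩
      simp only [Equiv.Perm.mul_apply] at h'
      rcases hsw (π s) with ⟨a, b⟩ | ⟨a, b⟩ | ⟨a, a', b⟩ <;> rw [b] at h' <;>
        simp only [Fin.le_def, Fin.ext_iff, ne_eq] at * <;> omega
    · exact h s h3 h4

theorem hasDominant_bridgePerms {n : ℕ} (J : Finset (Fin n)) : HasDominant (bridgePerms J) := by
  induction hN : ∑ j ∈ J, (n - (j : ℕ)) using Nat.strong_induction_on generalizing J with
  | _ N ih =>
    by_cases hJ : IsUpperSet (J : Set (Fin n))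
    · intro c
      refine ⟨1, ⟨fun _ _ => le_rfl, fun _ _ => le_rfl⟩, fun y hy t m => ?_⟩
      rw [eq_one_of_isUpperSet hJ hy]
    · obtain ⟨j, k, hjk, hj, hk⟩ := exists_adjacent_of_not_isUpperSet hJ
      rw [bridgePerms_eq_union hjk hj hk]
      -- Replacing `j ∈ J` by `k = j + 1` lowers the sum of `n - j` over `J`, so the induction
      -- hypothesis applies.
      refine HasDominant.union_swap (HasDominant.comp (ih _ ?_ _ rfl) _) hjk
      rw [← hN, Finset.sum_map]
      refine Finset.sum_lt_sum (fun i hi => ?_) ⟨j, hj, ?_⟩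
      · simp only [Equiv.coe_toEmbedding]
        have hik : i ≠ k := fun h => hk (h ▸ hi)
        rcases eq_or_ne i j with rfl | hij
        · rw [Equiv.swap_apply_left]; omega
        · rw [Equiv.swap_apply_of_ne_of_ne hij hik]
      · simp only [Equiv.coe_toEmbedding, Equiv.swap_apply_left]
        omega

/-! ### Abel summation and the rigidity of maximizers -/

/-- Abel summation over the distinct values of `c`: the sum is a combination of the upper level sums
with the positive gaps between consecutive values as coefficients, plus a multiple of the vanishing
total. Equality therefore forces every level sum to vanish. -/
theorem sum_mul_le_zero_and_eq {ι : Type*} [Fintype ι] (a : ι → ℝ) (hsum : ∑ p, a p = 0)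
    (T : Finset ℝ) : ∀ c : ι → ℝ, (∀ p, c p ∈ T) →
      (∀ t, ∑ p with t ≤ c p, a p ≤ 0) →
      ∑ p, c p * a p ≤ 0 ∧ (∑ p, c p * a p = 0 → ∀ t, ∑ p with t ≤ c p, a p = 0) := by
  induction T using Finset.induction_on_max with
  | empty =>
    intro c hc _
    have : IsEmpty ι := ⟨fun p => by simpa using hc p⟩
    simp
  | insert M T hM ih =>
    intro c hc hle
    rcases T.eq_empty_or_nonempty with rfl | hT
    · have hcM : ∀ p, c p = M := fun p => by simpa using hc p
      simp only [hcM, ← Finset.mul_sum, hsum, mul_zero, le_refl, true_and, true_implies]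
      intro t
      by_cases h : t ≤ M <;> simp [h, hsum]
    · set M' := T.max' hT with hM'
      have hM'M : M' < M := hM _ (T.max'_mem hT)
      have hcases : ∀ p, c p = M ∨ c p ≤ M' := fun p => by
        rcases Finset.mem_insert.1 (hc p) with h | h
        · exact Or.inl h
        · exact Or.inr (T.le_max' _ h)
      have hlevel : ∀ t, ∑ p with t ≤ min (c p) M', a p ≤ 0 := by
        intro t
        by_cases ht : t ≤ M'
        · simpa [ht] using hle t
        · simp [ht]
      obtain ⟨ih1, ih2⟩ := ih (fun p => min (c p) M') (fun p => by
        rcases Finset.mem_insert.1 (hc p) with h | h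
        · rw [h, min_eq_right hM'M.le]; exact T.max'_mem hT
        · rw [min_eq_left (T.le_max' _ h)]; exact h) hlevel
      -- Lowering the top value `M` to the next value `M'` splits off one gap times one level sum.
      have split : ∑ p, c p * a p = ∑ p, min (c p) M' * a p + (M - M') * ∑ p with M ≤ c p, a p := by
        rw [Finset.mul_sum, Finset.sum_filter, ← Finset.sum_add_distrib]
        refine Finset.sum_congr rfl fun p _ => ?_
        rcases hcases p with h | h
        · rw [h, min_eq_right hM'M.le, if_pos le_rfl]; ring
        · rw [min_eq_left h, if_neg (by linarith)]; ring
      have hG := hle M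
      have hprod : (M - M') * ∑ p with M ≤ c p, a p ≤ 0 :=
        mul_nonpos_of_nonneg_of_nonpos (by linarith) hG
      refine ⟨by rw [split]; linarith, fun h0 t => ?_⟩
      have h1 : ∑ p, min (c p) M' * a p = 0 := by linarith
      have h2 : ∑ p with M ≤ c p, a p = 0 := by
        have : (M - M') * ∑ p with M ≤ c p, a p = 0 := by linarith
        rcases mul_eq_zero.1 this with h | h
        · linarith
        · exact h
      have h3 := ih2 h1
      by_cases ht : t ≤ M'
      · simpa [ht] using h3 t
      have hMe : ∀ p, t ≤ c p → M ≤ c p := fun p h => by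
        rcases hcases p with h' | h'
        · exact h'.ge
        · exact absurd (h.trans h') ht
      by_cases htM : t ≤ M
      · rw [← h2]
        exact Finset.sum_congr (Finset.filter_congr fun p _ => ⟨hMe p, htM.trans⟩) fun _ _ => rfl
      · refine Finset.sum_eq_zero fun p hp => ?_
        rw [Finset.mem_filter] at hp
        rcases hcases p with h' | h' <;> linarith [hp.2]

/-- The value at `(π(1), …, π(n))`, up to a constant, of the linear functional with
coefficients `c`. -/
noncomputable def weight {n : ℕ} (c : Fin n → ℝ) (π : Equiv.Perm (Fin n)) : ℝ :=
  ∑ p, c p * ((π p : ℕ) : ℝ)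

/-- The members of `S_J` of maximal weight. -/
def maximizers {n : ℕ} (J : Finset (Fin n)) (c : Fin n → ℝ) : Set (Equiv.Perm (Fin n)) :=
  {π | π ∈ bridgePerms J ∧ ∀ σ ∈ bridgePerms J, weight c σ ≤ weight c π}

/-- Layer-cake form: each value is the number of thresholds `m + 1` that it reaches. This brings the
weight into the range of the Abel summation, one threshold at a time. -/
theorem weight_eq_sum {n : ℕ} (c : Fin n → ℝ) (y : Equiv.Perm (Fin n)) :
    weight c y = ∑ m ∈ Finset.range n, ∑ p, c p * if m + 1 ≤ (y p : ℕ) then 1 else 0 := by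
  rw [weight, Finset.sum_comm]
  refine Finset.sum_congr rfl fun p _ => ?_
  rw [← Finset.mul_sum, ← Finset.sum_filter, Finset.sum_const, nsmul_one]
  have : (Finset.range n).filter (fun m => m + 1 ≤ (y p : ℕ)) = Finset.range (y p : ℕ) := by
    ext m
    simp only [Finset.mem_filter, Finset.mem_range]
    have := (y p).isLt
    omega
  rw [this, Finset.card_range]

theorem sum_ite_eq_levelCount {n : ℕ} (c : Fin n → ℝ) (y : Equiv.Perm (Fin n)) (t : ℝ) (m : ℕ) :
    ∑ p with t ≤ c p, (if m ≤ (y p : ℕ) then (1 : ℝ) else 0) = levelCount c y t m := by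
  rw [levelCount, ← Finset.filter_filter, Finset.card_filter]
  push_cast
  rfl

theorem sum_ite_le_perm_eq {n : ℕ} (y x : Equiv.Perm (Fin n)) (m : ℕ) :
    ∑ p, (if m ≤ (y p : ℕ) then (1 : ℝ) else 0) = ∑ p, if m ≤ (x p : ℕ) then (1 : ℝ) else 0 := by
  rw [Equiv.sum_comp y (fun v : Fin n => if m ≤ (v : ℕ) then (1 : ℝ) else 0),
    Equiv.sum_comp x (fun v : Fin n => if m ≤ (v : ℕ) then (1 : ℝ) else 0)]

/-- The weight difference between a maximizer and the dominant `x` is a sum of nonpositive terms,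
one per threshold, and is itself nonnegative. So each term vanishes, and the equality case of Abel
summation applies. -/
theorem exists_levelCount_eq {n : ℕ} (J : Finset (Fin n)) (c : Fin n → ℝ) :
    ∃ x, ∀ y ∈ maximizers J c, ∀ t, ∀ m < n,
      levelCount c y t (m + 1) = levelCount c x t (m + 1) := by
  obtain ⟨x, hx, hdom⟩ := hasDominant_bridgePerms J c
  refine ⟨x, fun y hy => ?_⟩
  set a : ℕ → Fin n → ℝ := fun m p =>
    (if m + 1 ≤ (y p : ℕ) then (1 : ℝ) else 0) - if m + 1 ≤ (x p : ℕ) then (1 : ℝ) else 0 with ha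
  have hlevel : ∀ m t, ∑ p with t ≤ c p, a m p =
      (levelCount c y t (m + 1) : ℝ) - levelCount c x t (m + 1) := fun m t => by
    rw [← sum_ite_eq_levelCount, ← sum_ite_eq_levelCount, ← Finset.sum_sub_distrib]
  have habel := fun m => sum_mul_le_zero_and_eq (a m)
    (by simp only [ha, Finset.sum_sub_distrib]; rw [sum_ite_le_perm_eq y x, sub_self])
    (Finset.univ.image c) c (fun p => Finset.mem_image_of_mem _ (Finset.mem_univ p)) (fun t => by
      rw [hlevel, sub_nonpos]
      exact_mod_cast hdom y hy.1 t (m + 1))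
  have htot : ∑ m ∈ Finset.range n, ∑ p, c p * a m p = weight c y - weight c x := by
    simp only [ha, weight_eq_sum, mul_sub, Finset.sum_sub_distrib]
  have hzero : ∑ m ∈ Finset.range n, ∑ p, c p * a m p = 0 := le_antisymm
    (Finset.sum_nonpos fun m _ => (habel m).1) (by rw [htot, sub_nonneg]; exact hy.2 x hx)
  rw [Finset.sum_eq_zero_iff_of_nonpos fun m _ => (habel m).1] at hzero
  intro t m hm
  have := (habel m).2 (hzero m (Finset.mem_range.2 hm)) t
  rw [hlevel, sub_eq_zero] at this
  exact_mod_cast this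

/-- Every value is carried by positions of the same coefficient in all maximizers. -/
theorem apply_symm_eq {n : ℕ} {J : Finset (Fin n)} {c : Fin n → ℝ} {y z : Equiv.Perm (Fin n)}
    (hy : y ∈ maximizers J c) (hz : z ∈ maximizers J c) (v : Fin n) :
    c (y.symm v) = c (z.symm v) := by
  obtain ⟨x, hx⟩ := exists_levelCount_eq J c
  have zero : ∀ (w : Equiv.Perm (Fin n)) t, levelCount c w t 0 = (Finset.univ.filter
      fun p => t ≤ c p).card := fun w t => by simp [levelCount]
  have heq : ∀ t, ∀ m ≤ n, levelCount c y t m = levelCount c z t m := by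
    intro t m hm
    cases m with
    | zero => rw [zero, zero]
    | succ m => rw [hx y hy t m hm, hx z hz t m hm]
  -- The counts at `v` and `v + 1` differ by the indicator that the position of `v` has coefficient
  -- at least `t`.
  have hiff : ∀ t, t ≤ c (y.symm v) ↔ t ≤ c (z.symm v) := by
    intro t
    have h1 := levelCount_succ c y t v
    have h2 := levelCount_succ c z t v
    rw [heq t v v.isLt.le, heq t (v + 1) v.isLt] at h1
    split_ifs at h1 h2 <;> first | tauto | omega
  exact le_antisymm ((hiff _).1 le_rfl) ((hiff _).2 le_rfl)

theorem level_sum_eq {n : ℕ} {J : Finset (Fin n)} {c : Fin n → ℝ} {y z : Equiv.Perm (Fin n)}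
    (hy : y ∈ maximizers J c) (hz : z ∈ maximizers J c) (t : ℝ) :
    ∑ p with c p = t, (((y p : ℕ) : ℝ) - ((z p : ℕ) : ℝ)) = 0 := by
  have key : ∀ w : Equiv.Perm (Fin n), ∑ p with c p = t, ((w p : ℕ) : ℝ) =
      ∑ v : Fin n, if c (w.symm v) = t then ((v : ℕ) : ℝ) else 0 := fun w => by
    rw [Finset.sum_filter,
      ← Equiv.sum_comp w fun v : Fin n => if c (w.symm v) = t then ((v : ℕ) : ℝ) else 0]
    simp
  rw [Finset.sum_sub_distrib, key, key, sub_eq_zero]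
  simp only [apply_symm_eq hy hz]

/-! ### Faces of the polytope and their vertices -/

/-- The linear functional with coefficients `c`. -/
noncomputable def functional {n : ℕ} (c : Fin n → ℝ) : EuclideanSpace ℝ (Fin n) →L[ℝ] ℝ :=
  innerSL ℝ (WithLp.toLp 2 c)

theorem functional_apply {n : ℕ} (c : Fin n → ℝ) (x : EuclideanSpace ℝ (Fin n)) :
    functional c x = ∑ p, c p * x p := by
  simp [functional, PiLp.inner_apply, mul_comm]

theorem exists_functional_eq {n : ℕ} (l : EuclideanSpace ℝ (Fin n) →L[ℝ] ℝ) :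
    ∃ c, functional c = l := by
  refine ⟨((InnerProductSpace.toDual ℝ (EuclideanSpace ℝ (Fin n))).symm l).ofLp, ?_⟩
  ext x
  simp [functional]

theorem functional_permPoint {n : ℕ} (c : Fin n → ℝ) (π : Equiv.Perm (Fin n)) :
    functional c (permPoint π) = weight c π + ∑ p, c p := by
  rw [functional_apply, weight, ← Finset.sum_add_distrib]
  exact Finset.sum_congr rfl fun p _ => by simp [permPoint, mul_add]

theorem permPoint_injective {n : ℕ} : Function.Injective (permPoint (n := n)) := by
  intro π σ h
  ext j
  have := congrArg (fun x : EuclideanSpace ℝ (Fin n) => x j) h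
  simpa [permPoint] using this

theorem norm_permPoint {n : ℕ} (π : Equiv.Perm (Fin n)) :
    ‖permPoint π‖ = √(∑ v : Fin n, (((v : ℕ) : ℝ) + 1) ^ 2) := by
  rw [EuclideanSpace.norm_eq, ← Equiv.sum_comp π fun v : Fin n => (((v : ℕ) : ℝ) + 1) ^ 2]
  simp [permPoint]

/-- All these points have the same norm, and every point of a sphere of positive radius is extreme
in the ball by strict convexity. So none of them is lost in the convex hull. -/
theorem extremePoints_convexHull_permPoint {n : ℕ} (V : Set (Equiv.Perm (Fin n))) :
    (convexHull ℝ (permPoint '' V)).extremePoints ℝ = permPoint '' V := by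
  refine Set.Subset.antisymm extremePoints_convexHull_subset ?_
  set r := √(∑ v : Fin n, (((v : ℕ) : ℝ) + 1) ^ 2) with hr
  have hball : convexHull ℝ (permPoint '' V) ⊆ Metric.closedBall 0 r := by
    refine convexHull_min ?_ (convex_closedBall 0 r)
    rintro _ ⟨π, -, rfl⟩
    simp [norm_permPoint, hr]
  rintro _ ⟨π, hπ, rfl⟩
  refine inter_extremePoints_subset_extremePoints_of_subset hball
    ⟨subset_convexHull ℝ _ ⟨π, hπ, rfl⟩, ?_⟩
  rcases eq_or_ne r 0 with h0 | h0
  · have : permPoint π = 0 := by rw [← norm_eq_zero, norm_permPoint, ← hr, h0]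
    rw [h0, Metric.closedBall_zero, this, extremePoints_singleton]
    rfl
  · refine StrictConvexSpace.sphere_subset_extremePoints_closedBall 0 h0 ?_
    rw [mem_sphere_zero_iff_norm, norm_permPoint]

theorem maximizers_nonempty {n : ℕ} (J : Finset (Fin n)) (c : Fin n → ℝ) :
    (maximizers J c).Nonempty := by
  obtain ⟨π, hπ, h⟩ := Set.exists_max_image (bridgePerms J) (weight c) (Set.toFinite _)
    ⟨1, fun _ _ => le_rfl, fun _ _ => le_rfl⟩
  exact ⟨π, hπ, h⟩

theorem functional_le_iff {n : ℕ} {J : Finset (Fin n)} {c : Fin n → ℝ} {M : ℝ} :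
    (∀ y ∈ bridgePolytope J, functional c y ≤ M) ↔
      ∀ σ ∈ bridgePerms J, functional c (permPoint σ) ≤ M := by
  refine ⟨fun h σ hσ => h _ (subset_convexHull ℝ _ ⟨σ, hσ, rfl⟩), fun h y hy => ?_⟩
  have : bridgePolytope J ⊆ {y | functional c y ≤ M} := by
    refine convexHull_min ?_ (convex_halfSpace_le (functional c).toLinearMap.isLinear M)
    rintro _ ⟨σ, hσ, rfl⟩
    exact h σ hσ
  exact this hy

theorem permPoint_mem_toExposed_iff {n : ℕ} {J : Finset (Fin n)} {c : Fin n → ℝ}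
    {π : Equiv.Perm (Fin n)} (hπ : π ∈ bridgePerms J) :
    permPoint π ∈ (functional c).toExposed (bridgePolytope J) ↔ π ∈ maximizers J c := by
  have hmem : permPoint π ∈ bridgePolytope J := subset_convexHull ℝ _ ⟨π, hπ, rfl⟩
  change (permPoint π ∈ bridgePolytope J ∧ _) ↔ _
  rw [functional_le_iff]
  simp only [functional_permPoint, add_le_add_iff_right]
  exact ⟨fun h => ⟨hπ, h.2⟩, fun h => ⟨hmem, h.2⟩⟩

/-- By Krein–Milman the exposed face is the closed hull of its extreme points; these are extreme in
the whole polytope, hence of the form `permPoint π` with `π` a maximizer. -/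
theorem toExposed_bridgePolytope {n : ℕ} (J : Finset (Fin n)) (c : Fin n → ℝ) :
    (functional c).toExposed (bridgePolytope J) = convexHull ℝ (permPoint '' maximizers J c) := by
  set P := bridgePolytope J with hP
  set F := (functional c).toExposed P with hF
  have hexp : IsExposed ℝ P F := ContinuousLinearMap.toExposed.isExposed
  have hPc : IsCompact P := ((Set.toFinite (bridgePerms J)).image permPoint).isCompact_convexHull ℝ
  have hPconv : Convex ℝ P := convex_convexHull ℝ _
  apply Set.Subset.antisymm
  · have hkm := closure_convexHull_extremePoints (hexp.isCompact hPc) (hexp.convex hPconv)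
    rw [← hkm]
    refine closure_minimal (convexHull_mono ?_)
      (((Set.toFinite (maximizers J c)).image permPoint).isClosed_convexHull ℝ)
    intro x hx
    obtain ⟨π, hπ, rfl⟩ : x ∈ permPoint '' bridgePerms J :=
      extremePoints_convexHull_subset (hexp.isExtreme.extremePoints_subset_extremePoints hx)
    exact ⟨π, (permPoint_mem_toExposed_iff hπ).1 (extremePoints_subset hx), rfl⟩
  · refine convexHull_min ?_ (hexp.convex hPconv)
    rintro _ ⟨π, hπ, rfl⟩
    exact (permPoint_mem_toExposed_iff hπ.1).2 hπ

/-- The linear hull of the differences of points of the face with vertex set `V`. -/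
noncomputable def directionSpan {n : ℕ} (V : Set (Equiv.Perm (Fin n))) :
    Submodule ℝ (EuclideanSpace ℝ (Fin n)) :=
  vectorSpan ℝ (permPoint '' V)

theorem isFaceOfDim_iff {n d : ℕ} {J : Finset (Fin n)} {F : Set (EuclideanSpace ℝ (Fin n))} :
    IsFaceOfDim d (bridgePolytope J) F ↔
      ∃ c, F = convexHull ℝ (permPoint '' maximizers J c) ∧
        Module.finrank ℝ (directionSpan (maximizers J c)) = d := by
  have hv : ∀ c, vectorSpan ℝ (convexHull ℝ (permPoint '' maximizers J c)) =
      directionSpan (maximizers J c) := fun c => by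
    rw [← direction_affineSpan, affineSpan_convexHull, direction_affineSpan]; rfl
  constructor
  · rintro ⟨hne, hexp, hd⟩
    obtain ⟨l, hl⟩ := hexp hne
    obtain ⟨c, rfl⟩ := exists_functional_eq l
    have : F = convexHull ℝ (permPoint '' maximizers J c) := by
      rw [← toExposed_bridgePolytope]; exact hl
    exact ⟨c, this, by rw [← hv, ← this, hd]⟩
  · rintro ⟨c, rfl, hd⟩
    refine ⟨((maximizers_nonempty J c).image _).convexHull, ?_, by rw [hv, hd]⟩
    rw [← toExposed_bridgePolytope]
    exact ContinuousLinearMap.toExposed.isExposed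

/-! ### Perturbed functionals and the dimension of a face -/

theorem weight_add_smul {n : ℕ} (c c₂ : Fin n → ℝ) (ε : ℝ) (π : Equiv.Perm (Fin n)) :
    weight (c + ε • c₂) π = weight c π + ε * weight c₂ π := by
  simp only [weight, Pi.add_apply, Pi.smul_apply, smul_eq_mul, Finset.mul_sum,
    ← Finset.sum_add_distrib]
  exact Finset.sum_congr rfl fun p _ => by ring

/-- A face of a face is a face. -/
theorem exists_maximizers_eq {n : ℕ} (J : Finset (Fin n)) (c c₂ : Fin n → ℝ) :
    ∃ c', maximizers J c' =
        {π | π ∈ maximizers J c ∧ ∀ σ ∈ maximizers J c, weight c₂ σ ≤ weight c₂ π} ∧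
      (∀ p q, c' p = c' q → c p = c q) ∧ (∀ p q, c' p = c' q → c₂ p = c₂ q) := by
  have hlim : ∀ a b : ℝ, Filter.Tendsto (fun ε : ℝ => a + ε * b) (nhdsWithin 0 (Set.Ioi 0)) (nhds a) := by
    intro a b
    have : Filter.Tendsto (fun ε : ℝ => a + ε * b) (nhds 0) (nhds (a + 0 * b)) :=
      (by fun_prop : Continuous fun ε : ℝ => a + ε * b).tendsto 0
    rw [zero_mul, add_zero] at this
    exact this.mono_left nhdsWithin_le_nhds
  -- Finitely many strict inequalities survive a small perturbation: those between weights make `c₂`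
  -- only a tie-breaker, and those between coefficients (`h2`) make the level sets finer.
  have h1 : ∀ᶠ ε in nhdsWithin (0 : ℝ) (Set.Ioi 0), ∀ π σ : Equiv.Perm (Fin n),
      weight c σ < weight c π → weight c σ + ε * weight c₂ σ < weight c π + ε * weight c₂ π :=
    Filter.eventually_all.2 fun π => Filter.eventually_all.2 fun σ => by
      by_cases h : weight c σ < weight c π
      · exact ((hlim _ _).eventually_lt (hlim _ _) h).mono fun ε hε _ => hε
      · exact Filter.Eventually.of_forall fun ε h' => absurd h' h
  have h2 : ∀ᶠ ε in nhdsWithin (0 : ℝ) (Set.Ioi 0), ∀ p q : Fin n,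
      c p < c q → c p + ε * c₂ p < c q + ε * c₂ q :=
    Filter.eventually_all.2 fun p => Filter.eventually_all.2 fun q => by
      by_cases h : c p < c q
      · exact ((hlim _ _).eventually_lt (hlim _ _) h).mono fun ε hε _ => hε
      · exact Filter.Eventually.of_forall fun ε h' => absurd h' h
  obtain ⟨ε, ⟨h1, h2⟩, hε⟩ := ((h1.and h2).and self_mem_nhdsWithin).exists
  have hε : 0 < ε := hε
  have hc : ∀ p q, (c + ε • c₂) p = (c + ε • c₂) q → c p = c q := by
    intro p q h
    simp only [Pi.add_apply, Pi.smul_apply, smul_eq_mul] at h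
    rcases lt_trichotomy (c p) (c q) with h' | h' | h'
    · exact absurd h (h2 p q h').ne
    · exact h'
    · exact absurd h (h2 q p h').ne'
  refine ⟨c + ε • c₂, ?_, hc, fun p q h => ?_⟩
  · obtain ⟨π₀, hπ₀⟩ := maximizers_nonempty J c
    ext π
    simp only [Set.mem_ofPred_eq, maximizers, weight_add_smul]
    constructor
    · rintro ⟨hπ, hmax⟩
      have hπc : ∀ σ ∈ bridgePerms J, weight c σ ≤ weight c π := by
        intro σ hσ
        by_contra hlt
        exact absurd (hmax σ hσ) (not_le.2 (h1 σ π (not_le.1 hlt)))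
      refine ⟨⟨hπ, hπc⟩, fun σ hσ => ?_⟩
      have e1 := hmax σ hσ.1
      have e2 := hσ.2 π hπ
      have e3 : ε * weight c₂ σ ≤ ε * weight c₂ π := by linarith
      exact le_of_mul_le_mul_left e3 hε
    · rintro ⟨⟨hπ, hπc⟩, hmax⟩
      refine ⟨hπ, fun σ hσ => ?_⟩
      rcases (hπc σ hσ).lt_or_eq with h | h
      · exact (h1 π σ h).le
      · have := hmax σ ⟨hσ, fun τ hτ => h ▸ hπc τ hτ⟩
        rw [h]
        have := mul_le_mul_of_nonneg_left this hε.le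
        linarith
  · have := hc p q h
    simp only [Pi.add_apply, Pi.smul_apply, smul_eq_mul, this, add_right_inj] at h
    exact mul_left_cancel₀ hε.ne' h

theorem permPoint_sub_mem {n : ℕ} {V : Set (Equiv.Perm (Fin n))} {π σ : Equiv.Perm (Fin n)}
    (hπ : π ∈ V) (hσ : σ ∈ V) : permPoint π - permPoint σ ∈ directionSpan V :=
  vsub_mem_vectorSpan ℝ ⟨π, hπ, rfl⟩ ⟨σ, hσ, rfl⟩

/-- Every face is the face of a functional that separates as many coordinates as possible. -/
theorem exists_generic {n : ℕ} (J : Finset (Fin n)) (c : Fin n → ℝ) :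
    ∃ c', maximizers J c' = maximizers J c ∧ ∀ p q, c' p = c' q →
      EuclideanSpace.single p (1 : ℝ) - EuclideanSpace.single q 1 ∈
        directionSpan (maximizers J c) := by
  classical
  have hex : ∃ k, ∃ c', maximizers J c' = maximizers J c ∧
      (Finset.univ.filter fun pq : Fin n × Fin n => c' pq.1 = c' pq.2).card = k := ⟨_, c, rfl, rfl⟩
  -- Among the functionals with this face, `c'` has the fewest coincidences between coefficients.
  obtain ⟨c', hc', hk⟩ := Nat.find_spec hex
  refine ⟨c', hc', fun p q hpq => ?_⟩
  by_contra hW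
  set W := directionSpan (maximizers J c) with hWdef
  -- A functional `u` orthogonal to the face is constant on its vertices. Adding a small multiple of
  -- it keeps the face but separates `p` from `q`, against minimality.
  obtain ⟨u, hu, hne⟩ : ∃ u ∈ Wᗮ, inner ℝ u
      (EuclideanSpace.single p (1 : ℝ) - EuclideanSpace.single q 1) ≠ 0 := by
    by_contra hcon
    push Not at hcon
    rw [← Submodule.orthogonal_orthogonal W] at hW
    exact hW ((Submodule.mem_orthogonal _ _).2 hcon)
  obtain ⟨c₃, h3, h4, h5⟩ := exists_maximizers_eq J c' u.ofLp
  have hconst : ∀ π ∈ maximizers J c, ∀ σ ∈ maximizers J c,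
      weight u.ofLp σ ≤ weight u.ofLp π := by
    intro π hπ σ hσ
    have h6 : inner ℝ u (permPoint π - permPoint σ) = 0 :=
      (Submodule.mem_orthogonal' _ _).1 hu _ (permPoint_sub_mem hπ hσ)
    have h7 : ∀ x, inner ℝ u x = functional u.ofLp x := fun x => rfl
    rw [h7, map_sub, functional_permPoint, functional_permPoint] at h6
    linarith
  have hV : maximizers J c₃ = maximizers J c := by
    rw [h3, hc']
    ext π
    exact ⟨fun h => h.1, fun h => ⟨h, hconst π h⟩⟩
  refine Nat.find_min hex (m := (Finset.univ.filter
    fun pq : Fin n × Fin n => c₃ pq.1 = c₃ pq.2).card) ?_ ⟨c₃, hV, rfl⟩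
  rw [← hk]
  refine Finset.card_lt_card ⟨fun pq h => ?_, fun h => ?_⟩
  · simp only [Finset.mem_filter, Finset.mem_univ, true_and] at h ⊢
    exact h4 _ _ h
  · have h6 := @h (p, q) (by simpa using hpq)
    simp only [Finset.mem_filter, Finset.mem_univ, true_and] at h6
    refine hne ?_
    have := h5 _ _ h6
    simp [inner_sub_right, EuclideanSpace.inner_single_right, this]

theorem level_sum_eq_zero_of_mem {n : ℕ} {J : Finset (Fin n)} {c : Fin n → ℝ}
    {d : EuclideanSpace ℝ (Fin n)} (hd : d ∈ directionSpan (maximizers J c)) (t : ℝ) :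
    ∑ p with c p = t, d p = 0 := by
  unfold directionSpan vectorSpan at hd
  induction hd using Submodule.span_induction with
  | mem x hx =>
    obtain ⟨_, ⟨y, hy, rfl⟩, _, ⟨z, hz, rfl⟩, rfl⟩ := hx
    rw [← level_sum_eq hy hz t]
    exact Finset.sum_congr rfl fun p _ => by simp [permPoint]
  | zero => simp
  | add x y _ _ hx hy => simp [Finset.sum_add_distrib, hx, hy]
  | smul a x _ hx => simp [← Finset.mul_sum, hx]

/-- The dimension of a face is the number of positions that are not chosen as the representative of
their level set. -/
theorem exists_representatives {n : ℕ} {J : Finset (Fin n)} {c : Fin n → ℝ}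
    (hc : ∀ p q, c p = c q → EuclideanSpace.single p (1 : ℝ) - EuclideanSpace.single q 1 ∈
        directionSpan (maximizers J c)) :
    ∃ rep : Fin n → Fin n, (∀ p, c (rep p) = c p) ∧ (∀ p q, c p = c q → rep p = rep q) ∧
      (Finset.univ.filter fun p => rep p ≠ p).card =
        Module.finrank ℝ (directionSpan (maximizers J c)) := by
  classical
  set W := directionSpan (maximizers J c) with hW
  set rep : Fin n → Fin n := fun p => Set.rangeSplitting c (Set.rangeFactorization c p) with hrep
  have h1 : ∀ p, c (rep p) = c p := fun p => Set.apply_rangeSplitting c _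
  have h2 : ∀ p q, c p = c q → rep p = rep q := fun p q h => by
    simp only [hrep]; congr 1; exact Subtype.ext h
  have h3 : ∀ p, rep (rep p) = rep p := fun p => h2 _ _ (h1 p)
  refine ⟨rep, h1, h2, ?_⟩
  -- Restriction to the non-representatives is an isomorphism: the vanishing level sums recover the
  -- coordinate at a representative, and the vectors `e_p - e_{rep p}` of `W` map to the standard
  -- basis.
  let R : W →ₗ[ℝ] ({p // rep p ≠ p} → ℝ) :=
    { toFun := fun d p => d.1 p.1
      map_add' := fun _ _ => rfl
      map_smul' := fun _ _ => rfl }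
  have hR : ∀ d p, R d p = d.1 p.1 := fun _ _ => rfl
  clear_value R
  have hinj : Function.Injective R := by
    rw [← LinearMap.ker_eq_bot, LinearMap.ker_eq_bot']
    rintro ⟨d, hd⟩ h0
    have h0' : ∀ p, rep p ≠ p → d p = 0 := fun p hp => (hR _ ⟨p, hp⟩).symm.trans (congrFun h0 ⟨p, hp⟩)
    ext p
    by_cases hp : rep p = p
    · have := level_sum_eq_zero_of_mem hd (c p)
      rw [Finset.sum_eq_single p] at this
      · simpa using this
      · intro q hq hqp
        simp only [Finset.mem_filter, Finset.mem_univ, true_and] at hq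
        refine h0' q fun h => hqp ?_
        rw [← h, h2 q p hq, hp]
      · simp
    · simpa using h0' p hp
  have hsurj : Function.Surjective R := by
    intro f
    refine ⟨∑ p, f p • ⟨_, hc p.1 (rep p.1) (h1 p.1).symm⟩, ?_⟩
    ext q
    simp only [map_sum, map_smul, Finset.sum_apply, Pi.smul_apply, smul_eq_mul]
    rw [Finset.sum_eq_single q]
    · have : q.1 ≠ rep q.1 := q.2.symm
      simp [hR, this]
    · intro p _ hpq
      have e1 : q.1 ≠ p.1 := fun h => hpq (Subtype.ext h.symm)
      have e2 : q.1 ≠ rep p.1 := fun h => q.2 (by rw [h, h3])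
      simp [hR, e1, e2]
    · simp
  rw [(LinearEquiv.ofBijective R ⟨hinj, hsurj⟩).finrank_eq, Module.finrank_fintype_fun_eq_card,
    Fintype.card_subtype]

theorem eq_of_singleton_level {n : ℕ} {J : Finset (Fin n)} {c : Fin n → ℝ}
    {y z : Equiv.Perm (Fin n)} (hy : y ∈ maximizers J c) (hz : z ∈ maximizers J c) {s : Fin n}
    (hs : ∀ s', c s' = c s → s' = s) : y s = z s := by
  have h := level_sum_eq hy hz (c s)
  have : (Finset.univ.filter fun p => c p = c s) = {s} := by
    ext p
    simp only [Finset.mem_filter, Finset.mem_univ, true_and, Finset.mem_singleton]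
    exact ⟨hs p, fun h => by rw [h]⟩
  rw [this, Finset.sum_singleton, sub_eq_zero] at h
  exact Fin.ext (by exact_mod_cast h)

/-- If position `p` were constant on `V`, all directions would vanish at `p`, but `e_p - e_q` does
not. -/
theorem exists_value_ne {n : ℕ} {V : Set (Equiv.Perm (Fin n))} {p q : Fin n} (hpq : p ≠ q)
    (h : EuclideanSpace.single p (1 : ℝ) - EuclideanSpace.single q 1 ∈ directionSpan V)
    (v : Fin n) : ∃ y ∈ V, y p ≠ v := by
  by_contra hcon
  push Not at hcon
  have : ∀ d ∈ directionSpan V, d p = 0 := by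
    intro d hd
    unfold directionSpan vectorSpan at hd
    induction hd using Submodule.span_induction with
    | mem x hx =>
      obtain ⟨_, ⟨y, hy, rfl⟩, _, ⟨z, hz, rfl⟩, rfl⟩ := hx
      simp [permPoint, hcon y hy, hcon z hz]
    | zero => simp
    | add x y _ _ hx hy => simp [hx, hy]
    | smul a x _ hx => simp [hx]
  have := this _ h
  simp [hpq] at this

/-! ### Exchange arguments on a face -/

theorem weight_eq_add_of_eqOn {n : ℕ} (c : Fin n → ℝ) {x z : Equiv.Perm (Fin n)}
    (B : Finset (Fin n)) (h : ∀ s ∉ B, z s = x s) :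
    weight c z = weight c x + ∑ s ∈ B, c s * (((z s : ℕ) : ℝ) - ((x s : ℕ) : ℝ)) := by
  rw [← sub_eq_iff_eq_add']
  simp only [weight, ← Finset.sum_sub_distrib, ← mul_sub]
  refine (Finset.sum_subset (Finset.subset_univ B) fun s _ hs => ?_).symm
  rw [h s hs, sub_self, mul_zero]

theorem weight_mul_swap {n : ℕ} (c : Fin n → ℝ) (x : Equiv.Perm (Fin n)) {p q : Fin n}
    (hpq : p ≠ q) : weight c (x * Equiv.swap p q) =
      weight c x + (c p - c q) * (((x q : ℕ) : ℝ) - ((x p : ℕ) : ℝ)) := by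
  rw [weight_eq_add_of_eqOn c (x := x) {p, q}, Finset.sum_pair hpq]
  · simp only [Equiv.Perm.mul_apply, Equiv.swap_apply_left, Equiv.swap_apply_right]
    ring
  · intro s hs
    simp only [Finset.mem_insert, Finset.mem_singleton, not_or] at hs
    rw [Equiv.Perm.mul_apply, Equiv.swap_apply_of_ne_of_ne hs.1 hs.2]

theorem mul_swap_mem_bridgePerms {n : ℕ} {J : Finset (Fin n)} {x : Equiv.Perm (Fin n)}
    (hx : x ∈ bridgePerms J) {p q : Fin n} (hp : Allowed J p (x q)) (hq : Allowed J q (x p)) :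
    x * Equiv.swap p q ∈ bridgePerms J := by
  rw [mem_bridgePerms_iff] at hx ⊢
  intro s
  rw [Equiv.Perm.mul_apply]
  rcases eq_or_ne s p with rfl | h1
  · rwa [Equiv.swap_apply_left]
  rcases eq_or_ne s q with rfl | h2
  · rwa [Equiv.swap_apply_right]
  · rw [Equiv.swap_apply_of_ne_of_ne h1 h2]; exact hx s

/-- No swap of two values increases the weight of a maximizer. -/
theorem not_allowed_swap {n : ℕ} {J : Finset (Fin n)} {c : Fin n → ℝ} {x : Equiv.Perm (Fin n)}
    (hx : x ∈ maximizers J c) {p q : Fin n} (hv : x p < x q) (hc : c q < c p)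
    (hp : Allowed J p (x q)) (hq : Allowed J q (x p)) : False := by
  have h := hx.2 _ (mul_swap_mem_bridgePerms hx.1 hp hq)
  rw [weight_mul_swap c x (by rintro rfl; exact hv.false)] at h
  have h1 : ((x p : ℕ) : ℝ) < ((x q : ℕ) : ℝ) := by exact_mod_cast hv
  have := mul_pos (sub_pos.2 hc) (sub_pos.2 h1)
  linarith

theorem Allowed.mono {n : ℕ} {J : Finset (Fin n)} {s a b v : Fin n} (ha : Allowed J s a)
    (hb : Allowed J s b) (h1 : a ≤ v) (h2 : v ≤ b) : Allowed J s v :=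
  ⟨fun h => (ha.1 h).trans h1, fun h => h2.trans (hb.2 h)⟩

/-- A value strictly between two values that a position `p` takes on a face is carried by a position
strictly between the two values. -/
theorem between_of_between {n : ℕ} {J : Finset (Fin n)} {c : Fin n → ℝ}
    {y z : Equiv.Perm (Fin n)} (hy : y ∈ maximizers J c) (hz : z ∈ maximizers J c) {p w : Fin n}
    (hw : y w = z w) (ha : z p < y w) (hb : y w < y p) (hc : c w ≠ c p) :
    z p < w ∧ w < y p ∧ (c p < c w → w ∉ J) ∧ (c w < c p → w ∈ J) := by
  have hy' := mem_bridgePerms_iff.1 hy.1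
  have hz' := mem_bridgePerms_iff.1 hz.1
  have hpw : Allowed J p (y w) := (hz' p).mono (hy' p) ha.le hb.le
  have hww := hy' w
  rcases hc.lt_or_gt with hlt | hlt
  · have hna : ¬ Allowed J w (z p) := fun h =>
      not_allowed_swap hz (hw ▸ ha) hlt (hw ▸ hpw) h
    by_cases hJ : w ∈ J
    · have h1 : ¬ w ≤ z p := fun h => hna ⟨fun _ => h, fun h' => absurd hJ h'⟩
      exact ⟨not_le.1 h1, (hww.1 hJ).trans_lt hb, fun h => absurd h hlt.not_gt, fun _ => hJ⟩
    · exact absurd ⟨fun h => absurd h hJ, fun h => ha.le.trans (hww.2 h)⟩ hna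
  · have hna : ¬ Allowed J w (y p) := fun h => not_allowed_swap hy hb hlt h hpw
    by_cases hJ : w ∈ J
    · exact absurd ⟨fun h => (hww.1 h).trans hb.le, fun h => absurd hJ h⟩ hna
    · have h1 : ¬ y p ≤ w := fun h => hna ⟨fun h' => absurd h' hJ, fun _ => h⟩
      exact ⟨ha.trans_le (hww.2 hJ), not_le.1 h1, fun _ => hJ, fun h => absurd h hlt.not_gt⟩

/-! ### Level sets of edges and of two-dimensional faces -/

theorem eq_or_eq_mul_swap {n : ℕ} {x z : Equiv.Perm (Fin n)} {p q : Fin n}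
    (h : ∀ s, s ≠ p → s ≠ q → z s = x s) : z = x ∨ z = x * Equiv.swap p q := by
  have hfix : ∀ s, s ≠ p → s ≠ q → (x⁻¹ * z) s = s := fun s h1 h2 => by simp [h s h1 h2]
  have : x⁻¹ * z = 1 ∨ x⁻¹ * z = Equiv.swap p q := by
    by_cases hp : (x⁻¹ * z) p = p
    · left
      ext1 s
      rw [Equiv.Perm.one_apply]
      rcases eq_or_ne s p with rfl | h1
      · exact hp
      rcases eq_or_ne s q with rfl | h2
      · by_contra hne
        have h3 : (x⁻¹ * z) s ≠ p := fun h => h1 ((x⁻¹ * z).injective (h.trans hp.symm))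
        exact hne ((x⁻¹ * z).injective (hfix _ h3 hne))
      · exact hfix s h1 h2
    · right
      have hq : (x⁻¹ * z) p = q := by
        by_contra hne
        exact hp ((x⁻¹ * z).injective (hfix _ hp hne))
      have hpq : p ≠ q := fun h => hp (hq.trans h.symm)
      have hq' : (x⁻¹ * z) q = p := by
        by_contra hne
        have h3 : (x⁻¹ * z) q ≠ q := fun h => hpq ((x⁻¹ * z).injective (hq.trans h.symm))
        exact h3 ((x⁻¹ * z).injective (hfix _ hne h3))
      ext1 s
      rcases eq_or_ne s p with rfl | h1
      · rw [hq, Equiv.swap_apply_left]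
      rcases eq_or_ne s q with rfl | h2
      · rw [hq', Equiv.swap_apply_right]
      · rw [hfix s h1 h2, Equiv.swap_apply_of_ne_of_ne h1 h2]
  rcases this with h | h
  · left; rw [inv_mul_eq_one] at h; exact h.symm
  · right; rw [← h, mul_inv_cancel_left]

/-- The two ends of an edge differ by a transposition. -/
theorem exists_maximizers_eq_pair {n : ℕ} {J : Finset (Fin n)} {c : Fin n → ℝ}
    (hd : Module.finrank ℝ (directionSpan (maximizers J c)) = 1) :
    ∃ (π : Equiv.Perm (Fin n)) (p q : Fin n), p ≠ q ∧
      maximizers J c = {π, π * Equiv.swap p q} := by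
  obtain ⟨c', hc', hgen⟩ := exists_generic J c
  rw [← hc'] at hd hgen ⊢
  obtain ⟨rep, h1, h2, h3⟩ := exists_representatives hgen
  -- Dimension one leaves a single non-representative `q`, so `{rep q, q}` is the only level set
  -- that is not a singleton.
  rw [hd, Finset.card_eq_one] at h3
  obtain ⟨q, hq⟩ := h3
  have hN : ∀ s, rep s ≠ s ↔ s = q := fun s => by
    have := congrArg (s ∈ ·) hq
    simpa using this
  have hpq : rep q ≠ q := (hN q).2 rfl
  have hsing : ∀ s, s ≠ rep q → s ≠ q → ∀ s', c' s' = c' s → s' = s := by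
    intro s hs1 hs2 s' h
    have e1 : rep s = s := not_not.1 fun h => hs2 ((hN s).1 h)
    have e2 : rep s' = s := by rw [h2 s' s h, e1]
    by_contra hne
    have : s' = q := (hN s').1 (by rw [e2]; exact Ne.symm hne)
    exact hs1 (by rw [← this, e2])
  obtain ⟨π, hπ⟩ := maximizers_nonempty J c'
  have hsub : ∀ σ ∈ maximizers J c', σ = π ∨ σ = π * Equiv.swap (rep q) q := fun σ hσ =>
    eq_or_eq_mul_swap fun s hs1 hs2 => eq_of_singleton_level hσ hπ (hsing s hs1 hs2)
  refine ⟨π, rep q, q, hpq, Set.Subset.antisymm hsub ?_⟩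
  rintro σ (rfl | rfl)
  · exact hπ
  -- The value at `rep q` is not constant on the face, so the swapped permutation does occur.
  · obtain ⟨σ, hσ, hne⟩ := exists_value_ne hpq (hgen _ _ (h1 q)) (π (rep q))
    rcases hsub σ hσ with rfl | rfl
    · exact absurd rfl hne
    · exact hσ

/-- A functional defining a two-dimensional face can be chosen to have either one level set with
three elements or two level sets with two elements, all other level sets being singletons. -/
theorem exists_level_structure {n : ℕ} {J : Finset (Fin n)} {c : Fin n → ℝ}
    (hd : Module.finrank ℝ (directionSpan (maximizers J c)) = 2) :
    ∃ c', maximizers J c' = maximizers J c ∧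
      (∀ p q, p ≠ q → c' p = c' q → ∀ v, ∃ y ∈ maximizers J c', y p ≠ v) ∧
      ((∃ p q r, p ≠ q ∧ p ≠ r ∧ q ≠ r ∧ c' p = c' q ∧ c' p = c' r ∧
          ∀ s, s ≠ p → s ≠ q → s ≠ r → ∀ s', c' s' = c' s → s' = s) ∨
        ∃ p q r s, p ≠ q ∧ r ≠ s ∧ c' p = c' q ∧ c' r = c' s ∧ c' p ≠ c' r ∧
          ∀ u, u ≠ p → u ≠ q → u ≠ r → u ≠ s → ∀ s', c' s' = c' u → s' = u) := by
  obtain ⟨c', hc', hgen⟩ := exists_generic J c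
  rw [← hc'] at hd hgen
  refine ⟨c', hc', fun p q hpq h v => exists_value_ne hpq (hgen p q h) v, ?_⟩
  obtain ⟨rep, h1, h2, h3⟩ := exists_representatives hgen
  rw [hd, Finset.card_eq_two] at h3
  obtain ⟨q, r, hqr, hN'⟩ := h3
  have hN : ∀ s, rep s ≠ s ↔ s = q ∨ s = r := fun s => by
    have := congrArg (s ∈ ·) hN'
    simpa using this
  have hidem : ∀ s, rep (rep s) = rep s := fun s => h2 _ _ (h1 s)
  have hq := (hN q).2 (Or.inl rfl)
  have hr := (hN r).2 (Or.inr rfl)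
  have hrep : ∀ s, rep s ≠ q ∧ rep s ≠ r := fun s => by
    have := mt (hN (rep s)).2 (not_not.2 (hidem s))
    tauto
  have hsing : ∀ s, s ≠ rep q → s ≠ q → s ≠ rep r → s ≠ r → ∀ s', c' s' = c' s → s' = s := by
    intro s hs1 hs2 hs3 hs4 s' h
    have e1 : rep s = s := not_not.1 fun h => by have := (hN s).1 h; tauto
    have e2 : rep s' = s := by rw [h2 s' s h, e1]
    by_contra hne
    rcases (hN s').1 (by rw [e2]; exact Ne.symm hne) with h | h
    · exact hs1 (by rw [← h, e2])
    · exact hs3 (by rw [← h, e2])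
  -- The two non-representatives either share a representative, giving a triple, or belong to two
  -- disjoint pairs.
  by_cases heq : rep q = rep r
  · refine Or.inl ⟨rep q, q, r, hq, (hrep q).2, hqr, h1 q, by rw [heq, h1 r], ?_⟩
    intro s hs1 hs2 hs3
    exact hsing s hs1 hs2 (heq ▸ hs1) hs3
  · refine Or.inr ⟨rep q, q, rep r, r, hq, hr, h1 q, h1 r, fun h => heq ?_, hsing⟩
    rw [← hidem q, ← hidem r]
    exact h2 _ _ h

theorem mem_maximizers_of_eqOn {n : ℕ} {J : Finset (Fin n)} {c : Fin n → ℝ}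
    {x z : Equiv.Perm (Fin n)} (hx : x ∈ maximizers J c) (hz : z ∈ bridgePerms J)
    (h : weight c z = weight c x) : z ∈ maximizers J c :=
  ⟨hz, fun σ hσ => (hx.2 σ hσ).trans h.ge⟩

theorem mul_swap_mem_maximizers {n : ℕ} {J : Finset (Fin n)} {c : Fin n → ℝ}
    {x : Equiv.Perm (Fin n)} (hx : x ∈ maximizers J c) {p q : Fin n} (hpq : p ≠ q) (hc : c p = c q)
    (hp : Allowed J p (x q)) (hq : Allowed J q (x p)) :
    x * Equiv.swap p q ∈ maximizers J c :=
  mem_maximizers_of_eqOn hx (mul_swap_mem_bridgePerms hx.1 hp hq)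
    (by rw [weight_mul_swap c x hpq, hc, sub_self, zero_mul, add_zero])

/-! ### Stable intervals and crossings -/

/-- If all values strictly between `a` and `b` are carried by positions strictly between `a` and
`b`, then these positions carry only such values. -/
theorem mem_Ioo_of_position_mem {n : ℕ} {y : Equiv.Perm (Fin n)} {a b : Fin n}
    (h : ∀ w, a < y w → y w < b → a < w ∧ w < b) {w : Fin n} (h1 : a < w) (h2 : w < b) :
    a < y w ∧ y w < b := by
  have hsub : (Finset.Ioo a b).map y.symm.toEmbedding ⊆ Finset.Ioo a b := by
    intro w hw
    rw [Finset.mem_map_equiv, Equiv.symm_symm, Finset.mem_Ioo] at hw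
    exact Finset.mem_Ioo.2 (h w hw.1 hw.2)
  have heq := Finset.eq_of_subset_of_card_le hsub (by rw [Finset.card_map])
  have : w ∈ (Finset.Ioo a b).map y.symm.toEmbedding := by
    rw [heq]; exact Finset.mem_Ioo.2 ⟨h1, h2⟩
  rw [Finset.mem_map_equiv, Equiv.symm_symm, Finset.mem_Ioo] at this
  exact this

/-- The upward and the downward crossings of a threshold inside a stable interval are equinumerous.
-/
theorem card_crossings {n : ℕ} {y : Equiv.Perm (Fin n)} {a b : Fin n}
    (h : ∀ w, (a < y w ∧ y w < b) ↔ (a < w ∧ w < b)) (m : Fin n) :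
    (Finset.univ.filter fun w => (a < w ∧ w < b) ∧ w ≤ m ∧ m < y w).card =
      (Finset.univ.filter fun w => (a < w ∧ w < b) ∧ m < w ∧ y w ≤ m).card := by
  have h1 : (Finset.univ.filter fun w => (a < w ∧ w < b) ∧ w ≤ m).card =
      (Finset.univ.filter fun w => (a < w ∧ w < b) ∧ y w ≤ m).card := by
    symm
    refine Finset.card_bij' (fun w _ => y w) (fun w _ => y.symm w) (fun w hw => ?_)
      (fun w hw => ?_) (fun w _ => y.symm_apply_apply w) (fun w _ => y.apply_symm_apply w) <;>
      rw [Finset.mem_filter] at hw ⊢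
    · exact ⟨Finset.mem_univ _, (h w).2 hw.2.1, hw.2.2⟩
    · exact ⟨Finset.mem_univ _, (h _).1 (by rw [Equiv.apply_symm_apply]; exact hw.2.1),
        by rw [Equiv.apply_symm_apply]; exact hw.2.2⟩
  have h2 := Finset.card_filter_add_card_filter_not (fun w => m < y w)
    (s := Finset.univ.filter fun w => (a < w ∧ w < b) ∧ w ≤ m)
  have h3 := Finset.card_filter_add_card_filter_not (fun w => m < w)
    (s := Finset.univ.filter fun w => (a < w ∧ w < b) ∧ y w ≤ m)
  have e1 : (Finset.univ.filter fun w => (a < w ∧ w < b) ∧ w ≤ m).filter (fun w => ¬ m < y w) =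
      (Finset.univ.filter fun w => (a < w ∧ w < b) ∧ y w ≤ m).filter (fun w => ¬ m < w) := by
    ext w
    simp only [Finset.mem_filter, not_lt]
    tauto
  have e2 : (Finset.univ.filter fun w => (a < w ∧ w < b) ∧ w ≤ m).filter (fun w => m < y w) =
      Finset.univ.filter fun w => (a < w ∧ w < b) ∧ w ≤ m ∧ m < y w := by
    ext w
    simp only [Finset.mem_filter]
    tauto
  have e3 : (Finset.univ.filter fun w => (a < w ∧ w < b) ∧ y w ≤ m).filter (fun w => m < w) =
      Finset.univ.filter fun w => (a < w ∧ w < b) ∧ m < w ∧ y w ≤ m := by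
    ext w
    simp only [Finset.mem_filter]
    tauto
  rw [e1, e2] at h2
  rw [e3] at h3
  omega

/-- Let `(a, b)` be an interval permuted by `y` in which the positions of coefficient more than `t`
are exactly those not in `J`.  Then no downward crossing `r` in it is such that the values of all
upward crossings of the threshold `y r` exceed `r`. -/
theorem false_of_down_crossing {n : ℕ} {J : Finset (Fin n)} {c : Fin n → ℝ}
    {y : Equiv.Perm (Fin n)} (hy : y ∈ maximizers J c) {a b : Fin n} {t : ℝ}
    (h : ∀ w, (a < y w ∧ y w < b) ↔ (a < w ∧ w < b))
    (hJ : ∀ w, a < w → w < b → (t < c w ∧ w ∉ J) ∨ (c w < t ∧ w ∈ J))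
    {r : Fin n} (har : a < r) (hrb : r < b) (hr : y r < r)
    (hup : ∀ z, a < z → z ≤ y r → y r < y z → z ∈ J → r < y z) : False := by
  have hy' := mem_bridgePerms_iff.1 hy.1
  set m := y r with hm
  set Z := Finset.univ.filter fun w => (a < w ∧ w < b) ∧ w ≤ m ∧ m < y w with hZ
  set D := Finset.univ.filter fun w => (a < w ∧ w < b) ∧ m < w ∧ y w ≤ m with hD
  have hZD : Z.card = D.card := card_crossings h m
  have hrD : r ∈ D := by simp [hD, har, hrb, hr, hm.ge]
  have hZne : Z.Nonempty := by
    rw [← Finset.card_pos, hZD, Finset.card_pos]; exact ⟨r, hrD⟩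
  -- Take the upward crossing of `m = y r` with the least value, and compare with the threshold just
  -- below `y z`. All of `Z` still crosses that threshold upwards, while `r < y z` no longer crosses
  -- it downwards.
  obtain ⟨z, hzZ, hzmin⟩ := Finset.exists_min_image Z y hZne
  have memZ : ∀ w, w ∈ Z ↔ (a < w ∧ w < b) ∧ w ≤ m ∧ m < y w := fun w => by simp [hZ]
  have memD : ∀ w, w ∈ D ↔ (a < w ∧ w < b) ∧ m < w ∧ y w ≤ m := fun w => by simp [hD]
  have hz := (memZ z).1 hzZ
  have hzJ : z ∈ J := by
    by_contra hcon
    exact absurd ((hy' z).2 hcon) (not_le.2 (hz.2.1.trans_lt hz.2.2))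
  have hrz : r < y z := hup z hz.1.1 hz.2.1 hz.2.2 hzJ
  -- With `M = y z - 1`, exceeding `M` means being at least `y z`.
  obtain ⟨M, hM⟩ : ∃ M : Fin n, (M : ℕ) + 1 = y z := 
    ⟨⟨(y z : ℕ) - 1, by omega⟩, by have := Fin.lt_def.1 hrz; simp; omega⟩
  have hMlt : ∀ w : Fin n, M < w ↔ y z ≤ w := fun w => by
    rw [Fin.lt_def, Fin.le_def]; omega
  have hMle : ∀ w : Fin n, w ≤ M ↔ w < y z := fun w => by
    rw [Fin.lt_def, Fin.le_def]; omega
  have hcr := card_crossings h M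
  simp only [hMlt, hMle] at hcr
  have hZsub : Z ⊆ Finset.univ.filter fun w => (a < w ∧ w < b) ∧ w < y z ∧ y z ≤ y w := by
    intro w hw
    have h1 := (memZ w).1 hw
    simp only [Finset.mem_filter, Finset.mem_univ, true_and]
    exact ⟨h1.1, h1.2.1.trans_lt hz.2.2, hzmin w hw⟩
  have hcard := Finset.card_le_card hZsub
  by_cases hall : (Finset.univ.filter fun w => (a < w ∧ w < b) ∧ y z ≤ w ∧ y w < y z) ⊆ D.erase r
  · have h1 := Finset.card_le_card hall
    rw [Finset.card_erase_of_mem hrD] at h1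
    have := Finset.card_pos.2 ⟨r, hrD⟩
    omega
  -- By the count, some downward crossing `w` at the new threshold does not cross `m`, so `m < y w <
  -- y z ≤ w`. Exchanging the values at `w` and `z` is then allowed and raises the weight.
  · obtain ⟨w, hw, hwD⟩ := Finset.not_subset.1 hall
    simp only [Finset.mem_filter, Finset.mem_univ, true_and] at hw
    have hwr : w ≠ r := by rintro rfl; exact absurd hw.2.1 (not_le.2 hrz)
    have hmw : m < y w := by
      by_contra hcon
      exact hwD (Finset.mem_erase.2 ⟨hwr, (memD w).2
        ⟨hw.1, hz.2.2.trans_le hw.2.1, not_lt.1 hcon⟩⟩)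
    have hwJ : w ∉ J := fun hcon => absurd ((hy' w).1 hcon) (not_le.2 (hw.2.2.trans_le hw.2.1))
    have hcw : t < c w := by rcases hJ w hw.1.1 hw.1.2 with h | h; exacts [h.1, absurd h.2 hwJ]
    have hcz : c z < t := by rcases hJ z hz.1.1 hz.1.2 with h | h; exacts [absurd hzJ h.2, h.1]
    exact not_allowed_swap hy hw.2.2 (hcz.trans hcw) ⟨fun h => absurd h hwJ, fun _ => hw.2.1⟩
      ⟨fun _ => hz.2.1.trans hmw.le, fun h => absurd hzJ h⟩

/-- Reversal of positions and values maps faces to faces. -/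
theorem rev_mem_maximizers {n : ℕ} {J : Finset (Fin n)} {c : Fin n → ℝ} {x : Equiv.Perm (Fin n)}
    (hx : x ∈ maximizers J c) :
    Fin.revPerm * x * Fin.revPerm ∈
      maximizers (Finset.univ.filter fun j => Fin.rev j ∉ J) (fun j => - c (Fin.rev j)) := by
  have hall : ∀ s v : Fin n, Allowed (Finset.univ.filter fun j => Fin.rev j ∉ J) s v ↔
      Allowed J (Fin.rev s) (Fin.rev v) := by
    intro s v
    simp only [Allowed, Finset.mem_filter, Finset.mem_univ, true_and, not_not, Fin.rev_le_rev]
    exact and_comm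
  have hmem : ∀ z : Equiv.Perm (Fin n), Fin.revPerm * z * Fin.revPerm ∈
      bridgePerms (Finset.univ.filter fun j => Fin.rev j ∉ J) ↔ z ∈ bridgePerms J := by
    intro z
    simp only [mem_bridgePerms_iff, hall, Equiv.Perm.mul_apply, Fin.revPerm_apply, Fin.rev_rev]
    exact ⟨fun h s => by simpa using h (Fin.rev s), fun h s => h _⟩
  have hw : ∀ z : Equiv.Perm (Fin n), weight (fun j => - c (Fin.rev j))
      (Fin.revPerm * z * Fin.revPerm) = weight c z - ((n : ℝ) - 1) * ∑ p, c p := by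
    intro z
    rw [weight, ← Equiv.sum_comp Fin.revPerm, weight, Finset.mul_sum, ← Finset.sum_sub_distrib]
    refine Finset.sum_congr rfl fun p _ => ?_
    have : ((Fin.rev (z p) : ℕ) : ℝ) = (n : ℝ) - 1 - (z p : ℕ) := by
      rw [Fin.val_rev, Nat.cast_sub (by omega)]; push_cast; ring
    simp only [Equiv.Perm.mul_apply, Fin.revPerm_apply, Fin.rev_rev, this]
    ring
  refine ⟨(hmem x).2 hx.1, fun σ hσ => ?_⟩
  obtain ⟨z, rfl⟩ : ∃ z, σ = Fin.revPerm * z * Fin.revPerm :=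
    ⟨Fin.revPerm * σ * Fin.revPerm, by ext s; simp⟩
  rw [hw, hw]
  linarith [hx.2 z ((hmem z).1 hσ)]

/-! ### Two level pairs: neither nested nor crossing -/

/-- Swapping `p` and `q` in `x` stays on the face, so `p` takes both values there and
`between_of_between` applies to `x` and its swap. -/
theorem between_of_pair {n : ℕ} {J : Finset (Fin n)} {c : Fin n → ℝ} {x : Equiv.Perm (Fin n)}
    (hx : x ∈ maximizers J c) {p q : Fin n} (hc : c p = c q)
    (hsing : ∀ w, c w = c p → w = p ∨ w = q) (hp : Allowed J p (x q)) (hq : Allowed J q (x p))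
    {w : Fin n} (h1 : x p < x w) (h2 : x w < x q) :
    x p < w ∧ w < x q ∧ (c p < c w → w ∉ J) ∧ (c w < c p → w ∈ J) := by
  have hpq : p ≠ q := by rintro rfl; exact (h1.trans h2).false
  have hwp : w ≠ p := by rintro rfl; exact h1.false
  have hwq : w ≠ q := by rintro rfl; exact h2.false
  have hz := mul_swap_mem_maximizers hx hpq hc hp hq
  have e1 : (x * Equiv.swap p q) w = x w := by
    rw [Equiv.Perm.mul_apply, Equiv.swap_apply_of_ne_of_ne hwp hwq]
  have e2 : (x * Equiv.swap p q) p = x q := by rw [Equiv.Perm.mul_apply, Equiv.swap_apply_left]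
  have := between_of_between hz hx (p := p) e1 (by rwa [e1]) (by rwa [e1, e2])
    (fun h => by rcases hsing w h with h | h <;> contradiction)
  rwa [e2] at this

/-- The interval from `x p` to `x q` is stable under `x`, and the sign of `c w - c p` decides there
whether `w` lies in `J`. Thus `r ∉ J`; as `r` also admits `x s`, it satisfies `x r < x s ≤ r` and is
a forbidden downward crossing. -/
theorem not_nested_of_lt {n : ℕ} {J : Finset (Fin n)} {c : Fin n → ℝ} {x : Equiv.Perm (Fin n)}
    (hx : x ∈ maximizers J c) {p q r s : Fin n} (hpq : c p = c q)
    (hsing : ∀ w, c w = c p → w = p ∨ w = q) (hp : Allowed J p (x q)) (hq : Allowed J q (x p))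
    (hr : Allowed J r (x s)) (h1 : x p < x r) (h2 : x r < x s) (h3 : x s < x q)
    (hlt : c p < c r) : False := by
  have hx' := mem_bridgePerms_iff.1 hx.1
  have hbet := fun w => between_of_pair hx hpq hsing hp hq (w := w)
  have hiff : ∀ w, (x p < x w ∧ x w < x q) ↔ (x p < w ∧ w < x q) := fun w =>
    ⟨fun h => ⟨(hbet w h.1 h.2).1, (hbet w h.1 h.2).2.1⟩, fun h =>
      mem_Ioo_of_position_mem (fun w h1 h2 => ⟨(hbet w h1 h2).1, (hbet w h1 h2).2.1⟩) h.1 h.2⟩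
  have hJ : ∀ w, x p < w → w < x q → (c p < c w ∧ w ∉ J) ∨ (c w < c p ∧ w ∈ J) := by
    intro w hw1 hw2
    obtain ⟨h4, h5⟩ := (hiff w).2 ⟨hw1, hw2⟩
    have h6 := hbet w h4 h5
    rcases lt_trichotomy (c p) (c w) with h | h | h
    · exact Or.inl ⟨h, h6.2.2.1 h⟩
    · rcases hsing w h.symm with rfl | rfl
      · exact absurd h4 (lt_irrefl _)
      · exact absurd h5 (lt_irrefl _)
    · exact Or.inr ⟨h, h6.2.2.2 h⟩
  obtain ⟨hr1, hr2, hr3, -⟩ := hbet r h1 (h2.trans h3)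
  have hrJ := hr3 hlt
  have hsr : x s ≤ r := hr.2 hrJ
  refine false_of_down_crossing hx hiff hJ hr1 hr2 (h2.trans_le hsr) fun z hz1 hz2 hz3 hzJ => ?_
  -- If `x z ≤ r`, exchanging the values at `r` and `z` would be allowed and would raise the weight,
  -- since `c z < c p < c r`.
  by_contra hcon
  have hzq : z < x q := hz2.trans_lt (h2.trans h3)
  have hcz : c z < c p := by
    rcases hJ z hz1 hzq with h | h
    · exact absurd hzJ h.2
    · exact h.1
  exact not_allowed_swap hx hz3 (hcz.trans hlt) ⟨fun h => absurd h hrJ, fun _ => not_lt.1 hcon⟩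
    ⟨fun _ => hz2, fun h => absurd hzJ h⟩

/-- Reversing positions and values negates the coefficients and keeps the nesting, which exchanges
the two possible orders of `c p` and `c r`. -/
theorem not_nested {n : ℕ} {J : Finset (Fin n)} {c : Fin n → ℝ} {x : Equiv.Perm (Fin n)}
    (hx : x ∈ maximizers J c) {p q r s : Fin n} (hpq : c p = c q) (hrs : c r = c s)
    (hne : c p ≠ c r)
    (hsing : ∀ w, c w = c p → w = p ∨ w = q) (hp : Allowed J p (x q)) (hq : Allowed J q (x p))
    (hr : Allowed J r (x s)) (hs : Allowed J s (x r)) (h1 : x p < x r) (h2 : x r < x s)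
    (h3 : x s < x q) : False := by
  rcases hne.lt_or_gt with hlt | hlt
  · exact not_nested_of_lt hx hpq hsing hp hq hr h1 h2 h3 hlt
  · have hall : ∀ u v : Fin n, Allowed J u v →
        Allowed (Finset.univ.filter fun j => Fin.rev j ∉ J) (Fin.rev u) (Fin.rev v) := by
      intro u v h
      simp only [Allowed, Finset.mem_filter, Finset.mem_univ, true_and, not_not, Fin.rev_le_rev,
        Fin.rev_rev]
      exact h.symm
    have e : ∀ u, (Fin.revPerm * x * Fin.revPerm : Equiv.Perm (Fin n)) (Fin.rev u) = Fin.rev (x u) := fun u => by simp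
    refine not_nested_of_lt (rev_mem_maximizers hx) (p := Fin.rev q) (q := Fin.rev p)
      (r := Fin.rev s) (s := Fin.rev r) ?_ ?_ ?_ ?_ ?_ ?_ ?_ ?_ ?_
    · simp [hpq]
    · intro w hw
      simp only [Fin.rev_rev, neg_inj] at hw
      rcases hsing (Fin.rev w) (hw.trans hpq.symm) with h | h
      · exact Or.inr (by rw [← h, Fin.rev_rev])
      · exact Or.inl (by rw [← h, Fin.rev_rev])
    · rw [e]; exact hall _ _ hq
    · rw [e]; exact hall _ _ hp
    · rw [e]; exact hall _ _ hs
    · rw [e, e]; exact Fin.rev_lt_rev.2 h3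
    · rw [e, e]; exact Fin.rev_lt_rev.2 h2
    · rw [e, e]; exact Fin.rev_lt_rev.2 h1
    · simp only [Fin.rev_rev, neg_lt_neg_iff]; rwa [← hpq, ← hrs]

/-- After swapping `r` and `s`, position `s` carries a value between `x p` and `x q`, so `s` itself
lies in that interval. But `x` maps the interval to itself, although `x s` exceeds `x q`. -/
theorem not_crossing {n : ℕ} {J : Finset (Fin n)} {c : Fin n → ℝ} {x : Equiv.Perm (Fin n)}
    (hx : x ∈ maximizers J c) {p q r s : Fin n} (hpq : c p = c q) (hrs : c r = c s)
    (hsing : ∀ w, c w = c p → w = p ∨ w = q) (hp : Allowed J p (x q)) (hq : Allowed J q (x p))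
    (hr : Allowed J r (x s)) (hs : Allowed J s (x r)) (h1 : x p < x r) (h2 : x r < x q)
    (h3 : x q < x s) : False := by
  have hne : ∀ u v, x u < x v → u ≠ v := by rintro u v h rfl; exact h.false
  have hrs' := hne r s (h2.trans h3)
  have hy := mul_swap_mem_maximizers hx hrs' hrs hr hs
  have ep : (x * Equiv.swap r s) p = x p := by
    rw [Equiv.Perm.mul_apply,
      Equiv.swap_apply_of_ne_of_ne (hne p r h1) (hne p s (h1.trans (h2.trans h3)))]
  have eq : (x * Equiv.swap r s) q = x q := by
    rw [Equiv.Perm.mul_apply, Equiv.swap_apply_of_ne_of_ne (hne r q h2).symm (hne q s h3)]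
  have es : (x * Equiv.swap r s) s = x r := by rw [Equiv.Perm.mul_apply, Equiv.swap_apply_right]
  have hbet := between_of_pair hy hpq hsing (by rwa [eq]) (by rwa [ep]) (w := s)
    (by rwa [ep, es]) (by rwa [es, eq])
  rw [ep, eq] at hbet
  have := mem_Ioo_of_position_mem (y := x) (a := x p) (b := x q) (fun w h1 h2 => by
    have := between_of_pair hx hpq hsing hp hq h1 h2
    exact ⟨this.1, this.2.1⟩) hbet.1 hbet.2.1
  exact absurd this.2 h3.not_gt

/-- The faces with two level sets of two elements each. -/
theorem exists_rectangle {n : ℕ} {J : Finset (Fin n)} {c : Fin n → ℝ} {p q r s : Fin n}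
    (hpq : p ≠ q) (hrs : r ≠ s) (hcp : c p = c q) (hcr : c r = c s) (hne : c p ≠ c r)
    (hsing : ∀ u, u ≠ p → u ≠ q → u ≠ r → u ≠ s → ∀ s', c s' = c u → s' = u)
    (hvar : ∀ u v, u ≠ v → c u = c v → ∀ a, ∃ y ∈ maximizers J c, y u ≠ a) :
    ∃ x p q r s, x p < x q ∧ x q < x r ∧ x r < x s ∧ maximizers J c =
      {x, x * Equiv.swap p q, x * Equiv.swap p q * Equiv.swap r s, x * Equiv.swap r s} := by
  obtain ⟨x, hx⟩ := maximizers_nonempty J c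
  wlog h1 : x p < x q generalizing p q
  · exact this hpq.symm hcp.symm (hcp ▸ hne) (fun u a b => hsing u b a)
      (lt_of_le_of_ne (not_lt.1 h1) fun h => hpq (x.injective h.symm))
  wlog h2 : x r < x s generalizing r s
  · exact this hrs.symm hcr.symm (hcr ▸ hne) (fun u a b d e => hsing u a b e d)
      (lt_of_le_of_ne (not_lt.1 h2) fun h => hrs (x.injective h.symm))
  wlog h3 : x p < x r generalizing p q r s
  · refine this (p := r) (q := s) (r := p) (s := q) (hpq := hrs) (hrs := hpq) (hcp := hcr)
      (hcr := hcp) (hne := hne.symm) (hsing := fun u a b d e => hsing u d e a b) (h1 := h2)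
      (h2 := h1) (h3 := lt_of_le_of_ne (not_lt.1 h3) fun h => hne (by rw [x.injective h]))
  have hpr : p ≠ r := fun h => hne (by rw [h])
  have hps : p ≠ s := fun h => hne (by rw [h, hcr])
  have hqr : q ≠ r := fun h => hne (by rw [hcp, h])
  have hqs : q ≠ s := fun h => hne (by rw [hcp, h, hcr])
  have hsp : ∀ w, c w = c p → w = p ∨ w = q := by
    intro w hw
    by_contra hcon
    push Not at hcon
    by_cases hwr : w = r
    · exact hne (by rw [← hw, hwr])
    by_cases hws : w = s
    · exact hne (by rw [← hw, hws, hcr])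
    · exact hcon.1 (hsing w hcon.1 hcon.2 hwr hws p hw.symm).symm
  have hsr : ∀ w, c w = c r → w = r ∨ w = s := by
    intro w hw
    by_contra hcon
    push Not at hcon
    by_cases hwr : w = p
    · exact hne (by rw [← hw, hwr])
    by_cases hws : w = q
    · exact hne (by rw [← hw, hws, hcp])
    · exact hcon.1 (hsing w hwr hws hcon.1 hcon.2 r hw.symm).symm
  have hval : ∀ u v, (∀ w, c w = c u → w = u ∨ w = v) → ∀ y ∈ maximizers J c,
      y u = x u ∨ y u = x v := by
    intro u v h y hy
    have e := apply_symm_eq hx hy (y u)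
    rw [Equiv.symm_apply_apply] at e
    rcases h _ e with h | h
    · exact Or.inl (by rw [← h, Equiv.apply_symm_apply, h])
    · exact Or.inr (by rw [← h, Equiv.apply_symm_apply])
  -- Position `u` is not constant on the face, and only `x u` and `x v` are available to it.
  have hallow : ∀ u v, u ≠ v → c u = c v → (∀ w, c w = c u → w = u ∨ w = v) →
      Allowed J u (x v) := by
    intro u v huv hc h
    obtain ⟨y, hy, hyu⟩ := hvar u v huv hc (x u)
    rw [← (hval u v h y hy).resolve_left hyu]
    exact mem_bridgePerms_iff.1 hy.1 u
  have hsq : ∀ w, c w = c q → w = q ∨ w = p := fun w h => (hsp w (by rw [h, hcp])).symm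
  have hss : ∀ w, c w = c s → w = s ∨ w = r := fun w h => (hsr w (by rw [h, hcr])).symm
  have ap := hallow p q hpq hcp hsp
  have aq := hallow q p hpq.symm hcp.symm hsq
  have ar := hallow r s hrs hcr hsr
  have as := hallow s r hrs.symm hcr.symm hss
  have h4 : x q < x r := by
    by_contra hcon
    have h5 : x r < x q := lt_of_le_of_ne (not_lt.1 hcon) fun h => hqr (x.injective h.symm)
    rcases lt_trichotomy (x q) (x s) with h | h | h
    · exact not_crossing hx hcp hcr hsp ap aq ar as h3 h5 h
    · exact hqs (x.injective h)
    · exact not_nested hx hcp hcr hne hsp ap aq ar as h3 h2 h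
  refine ⟨x, p, q, r, s, h1, h4, h2, Set.Subset.antisymm (fun z hz => ?_) ?_⟩
  · have hoff : ∀ u, u ≠ p → u ≠ q → u ≠ r → u ≠ s → z u = x u := fun u a b d e =>
      eq_of_singleton_level hz hx (hsing u a b d e)
    rcases hval p q hsp z hz with hp | hp
    · have hq : z q = x q := (hval q p hsq z hz).resolve_right fun h =>
        hpq (z.injective (hp.trans h.symm))
      rcases eq_or_eq_mul_swap (x := x) (z := z) (p := r) (q := s) (fun u hr hs => by
        rcases eq_or_ne u p with rfl | h1
        · exact hp
        rcases eq_or_ne u q with rfl | h2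
        · exact hq
        exact hoff u h1 h2 hr hs) with h | h <;> simp [h]
    · have hq : z q = x p := (hval q p hsq z hz).resolve_left fun h =>
        hpq (z.injective (hp.trans h.symm))
      rcases eq_or_eq_mul_swap (x := x * Equiv.swap p q) (z := z) (p := r) (q := s)
        (fun u hr hs => by
        rw [Equiv.Perm.mul_apply]
        rcases eq_or_ne u p with rfl | h1
        · rw [hp, Equiv.swap_apply_left]
        rcases eq_or_ne u q with rfl | h2
        · rw [hq, Equiv.swap_apply_right]
        rw [Equiv.swap_apply_of_ne_of_ne h1 h2]
        exact hoff u h1 h2 hr hs) with h | h <;> simp [h]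
  · have m1 := mul_swap_mem_maximizers hx hpq hcp ap aq
    have m2 := mul_swap_mem_maximizers hx hrs hcr ar as
    have er : (x * Equiv.swap p q) r = x r := by
      rw [Equiv.Perm.mul_apply, Equiv.swap_apply_of_ne_of_ne hpr.symm hqr.symm]
    have es : (x * Equiv.swap p q) s = x s := by
      rw [Equiv.Perm.mul_apply, Equiv.swap_apply_of_ne_of_ne hps.symm hqs.symm]
    have m3 := mul_swap_mem_maximizers m1 hrs hcr (by rwa [es]) (by rwa [er])
    rintro z (rfl | rfl | rfl | rfl) <;> assumption

/-! ### One level triple -/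

theorem apply_mem_of_eqOn {n : ℕ} {x z : Equiv.Perm (Fin n)} {p q r : Fin n}
    (hz : ∀ s, s ≠ p → s ≠ q → s ≠ r → z s = x s) : z p = x p ∨ z p = x q ∨ z p = x r := by
  by_contra hcon
  push Not at hcon
  have hs : x (x.symm (z p)) = z p := x.apply_symm_apply _
  have ha : ∀ s, z p ≠ x s → x.symm (z p) ≠ s := fun s h h' => h (by rw [← hs, h'])
  have := hz _ (ha p hcon.1) (ha q hcon.2.1) (ha r hcon.2.2)
  rw [hs] at this
  exact ha p hcon.1 (z.injective this)

/-- The data of a two-dimensional face whose functional has a level set `{p, q, r}`, on which the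
face takes the values `i < j < k`. -/
structure TripleLevel {n : ℕ} (J : Finset (Fin n)) (c : Fin n → ℝ) (x : Equiv.Perm (Fin n))
    (p q r i j k : Fin n) : Prop where
  mem : x ∈ maximizers J c
  pq : p ≠ q
  pr : p ≠ r
  qr : q ≠ r
  cq : c p = c q
  cr : c p = c r
  sing : ∀ s, s ≠ p → s ≠ q → s ≠ r → ∀ s', c s' = c s → s' = s
  vals : ∀ v, (v = i ∨ v = j ∨ v = k) ↔ (v = x p ∨ v = x q ∨ v = x r)
  ij : i < j
  jk : j < k
  var : ∀ u v, u ≠ v → c u = c v → ∀ a, ∃ y ∈ maximizers J c, y u ≠ a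

namespace TripleLevel

variable {n : ℕ} {J : Finset (Fin n)} {c : Fin n → ℝ} {x : Equiv.Perm (Fin n)}
  {p q r i j k : Fin n}

theorem rotate (h : TripleLevel J c x p q r i j k) : TripleLevel J c x q r p i j k where
  mem := h.mem
  pq := h.qr
  pr := h.pq.symm
  qr := h.pr.symm
  cq := by rw [← h.cq, h.cr]
  cr := h.cq.symm
  sing s a b d := h.sing s d a b
  vals v := by rw [h.vals]; tauto
  ij := h.ij
  jk := h.jk
  var := h.var

theorem transpose (h : TripleLevel J c x p q r i j k) : TripleLevel J c x q p r i j k where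
  mem := h.mem
  pq := h.pq.symm
  pr := h.qr
  qr := h.pr
  cq := h.cq.symm
  cr := by rw [← h.cq, h.cr]
  sing s a b d := h.sing s b a d
  vals v := by rw [h.vals]; tauto
  ij := h.ij
  jk := h.jk
  var := h.var

theorem sing_p (h : TripleLevel J c x p q r i j k) {w : Fin n} (hw : c w = c p) :
    w = p ∨ w = q ∨ w = r := by
  by_contra hcon
  push Not at hcon
  exact hcon.1 (h.sing w hcon.1 hcon.2.1 hcon.2.2 p hw.symm).symm

theorem off (h : TripleLevel J c x p q r i j k) {z : Equiv.Perm (Fin n)}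
    (hz : z ∈ maximizers J c) (s : Fin n) (h1 : s ≠ p) (h2 : s ≠ q) (h3 : s ≠ r) : z s = x s :=
  eq_of_singleton_level hz h.mem (h.sing s h1 h2 h3)

theorem val (h : TripleLevel J c x p q r i j k) {z : Equiv.Perm (Fin n)}
    (hz : ∀ s, s ≠ p → s ≠ q → s ≠ r → z s = x s) : z p = i ∨ z p = j ∨ z p = k :=
  (h.vals _).2 (apply_mem_of_eqOn hz)

theorem exists_pos (h : TripleLevel J c x p q r i j k) {z : Equiv.Perm (Fin n)}
    (hz : z ∈ maximizers J c) {v : Fin n} (hv : v = i ∨ v = j ∨ v = k) :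
    z p = v ∨ z q = v ∨ z r = v := by
  have e := apply_symm_eq hz h.mem v
  have hx : c (x.symm v) = c p := by
    rcases (h.vals v).1 hv with rfl | rfl | rfl
    · rw [Equiv.symm_apply_apply]
    · rw [Equiv.symm_apply_apply, h.cq]
    · rw [Equiv.symm_apply_apply, h.cr]
  have hs : z (z.symm v) = v := z.apply_symm_apply v
  rcases h.sing_p (e.trans hx) with h | h | h <;> rw [h] at hs <;> tauto

/-- Position `p` is not always at `i` and not always at `k`. So it either takes the value `j` or
takes both `i` and `k`, and the values admitted by a position form an interval. -/
theorem allowed_mid (h : TripleLevel J c x p q r i j k) : Allowed J p j := by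
  obtain ⟨y, hy, h1⟩ := h.var p q h.pq h.cq i
  obtain ⟨z, hz, h2⟩ := h.var p q h.pq h.cq k
  have ay := mem_bridgePerms_iff.1 hy.1 p
  have az := mem_bridgePerms_iff.1 hz.1 p
  rcases h.val (h.off hy) with e | e | e
  · exact absurd e h1
  · rwa [e] at ay
  rcases h.val (h.off hz) with e' | e' | e'
  · rw [e] at ay
    rw [e'] at az
    exact az.mono ay h.ij.le h.jk.le
  · rwa [e'] at az
  · exact absurd e' h2

theorem allowed_end (h : TripleLevel J c x p q r i j k) : Allowed J p i ∨ Allowed J p k := by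
  obtain ⟨y, hy, h1⟩ := h.var p q h.pq h.cq j
  have ay := mem_bridgePerms_iff.1 hy.1 p
  rcases h.val (h.off hy) with e | e | e <;> rw [e] at ay <;> tauto

/-- The value `v` is not always at `r`, and when it is elsewhere it is at `p` or `q`. -/
theorem allowed_or (h : TripleLevel J c x p q r i j k) {v : Fin n} (hv : v = i ∨ v = j ∨ v = k) :
    Allowed J p v ∨ Allowed J q v := by
  obtain ⟨y, hy, h1⟩ := h.var r p h.pr.symm h.cr.symm v
  rcases h.exists_pos hy hv with e | e | e
  · exact Or.inl (e ▸ mem_bridgePerms_iff.1 hy.1 p)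
  · exact Or.inr (e ▸ mem_bridgePerms_iff.1 hy.1 q)
  · exact absurd e h1

/-- Rearranging values inside a level set preserves the weight, so only the constraints at `p`, `q`
and `r` matter. -/
theorem mem_iff (h : TripleLevel J c x p q r i j k) (z : Equiv.Perm (Fin n)) :
    z ∈ maximizers J c ↔ (∀ s, s ≠ p → s ≠ q → s ≠ r → z s = x s) ∧
      Allowed J p (z p) ∧ Allowed J q (z q) ∧ Allowed J r (z r) := by
  constructor
  · intro hz
    have := mem_bridgePerms_iff.1 hz.1
    exact ⟨h.off hz, this p, this q, this r⟩
  · rintro ⟨hoff, hp, hq, hr⟩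
    refine mem_maximizers_of_eqOn h.mem (mem_bridgePerms_iff.2 fun s => ?_) ?_
    · by_cases h1 : s = p
      · rwa [h1]
      by_cases h2 : s = q
      · rwa [h2]
      by_cases h3 : s = r
      · rwa [h3]
      · rw [hoff s h1 h2 h3]; exact mem_bridgePerms_iff.1 h.mem.1 s
    · have hB : ∀ s ∉ ({p, q, r} : Finset (Fin n)), z s = x s := fun s hs => by
        simp only [Finset.mem_insert, Finset.mem_singleton, not_or] at hs
        exact hoff s hs.1 hs.2.1 hs.2.2
      have h1 := weight_eq_add_of_eqOn (fun _ => c p) {p, q, r} hB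
      have h2 := weight_eq_add_of_eqOn c {p, q, r} hB
      -- A constant functional gives all permutations the same weight, and on `{p, q, r}` it agrees
      -- with `c`.
      have h3 : weight (fun _ => c p) z = weight (fun _ => c p) x := by
        simp only [weight, ← Finset.mul_sum]
        rw [Equiv.sum_comp z (fun v : Fin n => ((v : ℕ) : ℝ)),
          Equiv.sum_comp x (fun v : Fin n => ((v : ℕ) : ℝ))]
      have h4 : ∑ s ∈ {p, q, r}, c s * (((z s : ℕ) : ℝ) - ((x s : ℕ) : ℝ)) =
          ∑ s ∈ {p, q, r}, c p * (((z s : ℕ) : ℝ) - ((x s : ℕ) : ℝ)) := by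
        refine Finset.sum_congr rfl fun s hs => ?_
        simp only [Finset.mem_insert, Finset.mem_singleton] at hs
        rcases hs with rfl | rfl | rfl
        · rfl
        · rw [h.cq]
        · rw [h.cr]
      rw [h2, h4]
      linarith

theorem exists_arrangement (h : TripleLevel J c x p q r i j k) {a b d : Fin n} (hab : a ≠ b)
    (had : a ≠ d) (hbd : b ≠ d) (ha : a = i ∨ a = j ∨ a = k) (hb : b = i ∨ b = j ∨ b = k)
    (hd : d = i ∨ d = j ∨ d = k) :
    ∃ z : Equiv.Perm (Fin n), z p = a ∧ z q = b ∧ z r = d ∧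
      ∀ s, s ≠ p → s ≠ q → s ≠ r → z s = x s := by
  rw [h.vals] at ha hb hd
  set g : Fin n → Fin n := fun s => if s = p then a else if s = q then b else if s = r then d
    else x s with hg
  have hpq := h.pq
  have hpr := h.pr
  have hqr := h.qr
  have inj : Function.Injective g := by
    intro s t hst
    have hx : x s = x t → s = t := fun h => x.injective h
    have hxs : ∀ u, x s = x u → s = u := fun u h => x.injective h
    have hxt : ∀ u, x t = x u → t = u := fun u h => x.injective h
    simp only [hg] at hst
    grind
  refine ⟨Equiv.ofBijective g (Finite.injective_iff_bijective.1 inj), ?_, ?_, ?_, ?_⟩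
  · simp [hg]
  · simp [hg, h.pq.symm]
  · simp [hg, h.pr.symm, h.qr.symm]
  · intro s h1 h2 h3
    simp [hg, h1, h2, h3]

/-- The failures force `q ∈ J` with `i < q ≤ j` and `r ∉ J` with `j ≤ r < k`. In the vertex with `k,
j, i` at `p, q, r`, all values strictly between `i` and `k` then sit at positions in that interval.
By pigeonhole `r` should carry one of them, but it carries `i`. -/
theorem false_of_not_allowed (h : TripleLevel J c x p q r i j k) (hi : Allowed J p i)
    (hk : Allowed J p k) (hq : ¬ Allowed J q i) (hr : ¬ Allowed J r k) : False := by
  have aq := h.rotate.allowed_mid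
  have ar := h.rotate.rotate.allowed_mid
  have aqk := h.rotate.allowed_end.resolve_left hq
  have ari := h.rotate.rotate.allowed_end.resolve_right hr
  have ij := h.ij
  have jk := h.jk
  obtain ⟨y, y1, y2, y3, y4⟩ := h.exists_arrangement (a := k) (b := j) (d := i) jk.ne'
    (ij.trans jk).ne' ij.ne' (by simp) (by simp) (by simp)
  obtain ⟨z, z1, z2, z3, z4⟩ := h.exists_arrangement (a := i) (b := k) (d := j)
    (ij.trans jk).ne ij.ne jk.ne' (by simp) (by simp) (by simp)
  have hy : y ∈ maximizers J c := (h.mem_iff y).2 ⟨y4, by rwa [y1], by rwa [y2], by rwa [y3]⟩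
  have hz : z ∈ maximizers J c := (h.mem_iff z).2 ⟨z4, by rwa [z1], by rwa [z2], by rwa [z3]⟩
  have hqJ : q ∈ J := by
    by_contra hcon
    exact hq ⟨fun h => absurd h hcon, fun _ => ij.le.trans (aq.2 hcon)⟩
  have hrJ : r ∉ J := by
    intro hcon
    exact hr ⟨fun _ => (ar.1 hcon).trans jk.le, fun h => absurd hcon h⟩
  have hiq : i < q := by
    by_contra hcon
    exact hq ⟨fun _ => not_lt.1 hcon, fun h => absurd hqJ h⟩
  have hrk : r < k := by
    by_contra hcon
    exact hr ⟨fun h => absurd h hrJ, fun _ => not_lt.1 hcon⟩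
  have := mem_Ioo_of_position_mem (y := y) (a := i) (b := k) (w := r) (fun w h1 h2 => by
    by_cases hwp : w = p
    · rw [hwp, y1] at h2; exact absurd h2 (lt_irrefl _)
    by_cases hwr : w = r
    · rw [hwr, y3] at h1; exact absurd h1 (lt_irrefl _)
    by_cases hwq : w = q
    · rw [hwq]; exact ⟨hiq, (aq.1 hqJ).trans_lt jk⟩
    · have := between_of_between hy hz (p := p) (w := w)
        ((y4 w hwp hwq hwr).trans (z4 w hwp hwq hwr).symm) (by rwa [z1]) (by rwa [y1])
        (fun hc => by rcases h.sing_p hc with h | h | h <;> contradiction)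
      rw [z1, y1] at this
      exact ⟨this.1, this.2.1⟩) (ij.trans_le (ar.2 hrJ)) hrk
  rw [y3] at this
  exact this.1.false

theorem allowed_of_not_allowed (h : TripleLevel J c x p q r i j k)
    (hr : ¬ (Allowed J r i ∧ Allowed J r k)) : Allowed J p i ∧ Allowed J p k := by
  have pr_i := h.rotate.rotate.allowed_or (v := i) (by simp)
  have pr_k := h.rotate.rotate.allowed_or (v := k) (by simp)
  have pq_i := h.allowed_or (v := i) (by simp)
  have pq_k := h.allowed_or (v := k) (by simp)
  have qr_i := h.rotate.allowed_or (v := i) (by simp)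
  have qr_k := h.rotate.allowed_or (v := k) (by simp)
  have b1 := h.rotate.false_of_not_allowed
  have b2 := h.transpose.false_of_not_allowed
  tauto

/-- The faces with a level set of three elements. -/
theorem classify (h : TripleLevel J c x p q r i j k) :
    (∃ (x : Equiv.Perm (Fin n)) (p q r : Fin n), x p < x q ∧ x q < x r ∧
      ∀ z, z ∈ maximizers J c ↔ ∀ s, s ≠ p → s ≠ q → s ≠ r → z s = x s) ∨
    ∃ (x : Equiv.Perm (Fin n)) (p q r : Fin n),
      ((x p < x r ∧ x r < x q) ∨ (x q < x r ∧ x r < x p)) ∧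
      ∀ z, z ∈ maximizers J c ↔ (∀ s, s ≠ p → s ≠ q → s ≠ r → z s = x s) ∧ z r ≠ x q := by
  by_cases hfull : (Allowed J p i ∧ Allowed J p k) ∧ (Allowed J q i ∧ Allowed J q k) ∧
      (Allowed J r i ∧ Allowed J r k)
  · left
    obtain ⟨y, y1, y2, y3, y4⟩ := h.exists_arrangement (a := i) (b := j) (d := k) h.ij.ne
      (h.ij.trans h.jk).ne h.jk.ne (by simp) (by simp) (by simp)
    refine ⟨y, p, q, r, by rw [y1, y2]; exact h.ij, by rw [y2, y3]; exact h.jk, fun z => ?_⟩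
    constructor
    · intro hz s h1 h2 h3
      rw [h.off hz s h1 h2 h3, y4 s h1 h2 h3]
    · intro hz
      have hz' : ∀ s, s ≠ p → s ≠ q → s ≠ r → z s = x s := fun s h1 h2 h3 =>
        (hz s h1 h2 h3).trans (y4 s h1 h2 h3)
      refine (h.mem_iff z).2 ⟨hz', ?_, ?_, ?_⟩
      · rcases h.val hz' with e | e | e <;> rw [e]
        exacts [hfull.1.1, h.allowed_mid, hfull.1.2]
      · rcases h.rotate.val (fun s a b d => hz' s d a b) with e | e | e <;> rw [e]
        exacts [hfull.2.1.1, h.rotate.allowed_mid, hfull.2.1.2]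
      · rcases h.rotate.rotate.val (fun s a b d => hz' s b d a) with e | e | e <;> rw [e]
        exacts [hfull.2.2.1, h.rotate.rotate.allowed_mid, hfull.2.2.2]
  · right
    wlog hr : ¬ (Allowed J r i ∧ Allowed J r k) generalizing p q r
    · by_cases hp : Allowed J p i ∧ Allowed J p k
      · refine this h.transpose.rotate (by tauto) (by tauto)
      · exact this h.rotate (by tauto) hp
    have hp := h.allowed_of_not_allowed hr
    have hq := h.transpose.allowed_of_not_allowed hr
    -- Here `a` is the extreme value that `r` admits and `b` the one it does not. The reference
    -- vertex puts `b` at `q`, so that the only constraint reads `z r ≠ y q`.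
    have key : ∀ a b : Fin n, a ≠ b → a ≠ j → b ≠ j → (a = i ∨ a = j ∨ a = k) →
        (b = i ∨ b = j ∨ b = k) → Allowed J r a → ¬ Allowed J r b →
        ∃ y : Equiv.Perm (Fin n), y p = a ∧ y q = b ∧ y r = j ∧ 
        ∀ z, z ∈ maximizers J c ↔ (∀ s, s ≠ p → s ≠ q → s ≠ r → z s = y s) ∧ z r ≠ y q := by
      intro a b hab haj hbj ha hb h1 h2
      obtain ⟨y, y1, y2, y3, y4⟩ := h.exists_arrangement (a := a) (b := b) (d := j) hab haj hbj
        ha hb (by simp)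
      refine ⟨y, y1, y2, y3, fun z => ?_⟩
      constructor
      · intro hz
        refine ⟨fun s h1 h2 h3 => by rw [h.off hz s h1 h2 h3, y4 s h1 h2 h3], fun hcon => h2 ?_⟩
        rw [← y2, ← hcon]
        exact ((h.mem_iff z).1 hz).2.2.2
      · rintro ⟨hz, hne⟩
        have hz' : ∀ s, s ≠ p → s ≠ q → s ≠ r → z s = x s := fun s h1 h2 h3 =>
          (hz s h1 h2 h3).trans (y4 s h1 h2 h3)
        refine (h.mem_iff z).2 ⟨hz', ?_, ?_, ?_⟩
        · rcases h.val hz' with e | e | e <;> rw [e]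
          exacts [hp.1, h.allowed_mid, hp.2]
        · rcases h.rotate.val (fun s a b d => hz' s d a b) with e | e | e <;> rw [e]
          exacts [hq.1, h.rotate.allowed_mid, hq.2]
        · have hzr : z r = a ∨ z r = j := by
            have := h.rotate.rotate.val (fun s a b d => hz' s b d a)
            rw [y2] at hne
            grind
          rcases hzr with e | e <;> rw [e]
          exacts [h1, h.rotate.rotate.allowed_mid]
    have hend := h.rotate.rotate.allowed_end
    by_cases hri : Allowed J r i
    · have hrk : ¬ Allowed J r k := fun h => hr ⟨hri, h⟩
      obtain ⟨y, y1, y2, y3, y4⟩ := key i k (h.ij.trans h.jk).ne h.ij.ne h.jk.ne' (by simp)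
        (by simp) hri hrk
      refine ⟨y, p, q, r, Or.inl ?_, y4⟩
      rw [y1, y2, y3]
      exact ⟨h.ij, h.jk⟩
    · obtain ⟨y, y1, y2, y3, y4⟩ := key k i (h.ij.trans h.jk).ne' h.jk.ne' h.ij.ne (by simp)
        (by simp) (hend.resolve_left hri) hri
      refine ⟨y, p, q, r, Or.inr ?_, y4⟩
      rw [y1, y2, y3]
      exact ⟨h.ij, h.jk⟩

end TripleLevel

theorem exists_sorted {α : Type*} [LinearOrder α] {a b d : α} (hab : a ≠ b) (had : a ≠ d)
    (hbd : b ≠ d) :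
    ∃ i j k : α, i < j ∧ j < k ∧ ∀ v, (v = i ∨ v = j ∨ v = k) ↔ (v = a ∨ v = b ∨ v = d) := by
  rcases hab.lt_or_gt with h1 | h1 <;> rcases had.lt_or_gt with h2 | h2 <;>
    rcases hbd.lt_or_gt with h3 | h3
  · exact ⟨a, b, d, h1, h3, fun v => by tauto⟩
  · exact ⟨a, d, b, h2, h3, fun v => by tauto⟩
  · exact absurd (h1.trans h3) h2.not_gt
  · exact ⟨d, a, b, h2, h1, fun v => by tauto⟩
  · exact ⟨b, a, d, h1, h2, fun v => by tauto⟩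
  · exact absurd (h2.trans h3) h1.not_gt
  · exact ⟨b, d, a, h3, h2, fun v => by tauto⟩
  · exact ⟨d, b, a, h3, h1, fun v => by tauto⟩

/-- The three types of vertex sets of two-dimensional faces. -/
theorem classify_maximizers {n : ℕ} {J : Finset (Fin n)} {c : Fin n → ℝ}
    (hd : Module.finrank ℝ (directionSpan (maximizers J c)) = 2) :
    (∃ (x : Equiv.Perm (Fin n)) (p q r s : Fin n), x p < x q ∧ x q < x r ∧ x r < x s ∧
      maximizers J c =
        {x, x * Equiv.swap p q, x * Equiv.swap p q * Equiv.swap r s, x * Equiv.swap r s}) ∨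
    (∃ (x : Equiv.Perm (Fin n)) (p q r : Fin n),
      ((x p < x r ∧ x r < x q) ∨ (x q < x r ∧ x r < x p)) ∧
      ∀ z, z ∈ maximizers J c ↔ (∀ s, s ≠ p → s ≠ q → s ≠ r → z s = x s) ∧ z r ≠ x q) ∨
    (∃ (x : Equiv.Perm (Fin n)) (p q r : Fin n), x p < x q ∧ x q < x r ∧
      ∀ z, z ∈ maximizers J c ↔ ∀ s, s ≠ p → s ≠ q → s ≠ r → z s = x s) := by
  obtain ⟨c', hc', hvar, h⟩ := exists_level_structure hd
  rw [← hc']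
  rcases h with ⟨p, q, r, hpq, hpr, hqr, h1, h2, hsing⟩ | ⟨p, q, r, s, hpq, hrs, h1, h2, h3, hsing⟩
  · obtain ⟨x, hx⟩ := maximizers_nonempty J c'
    obtain ⟨i, j, k, hij, hjk, hvals⟩ := exists_sorted (x.injective.ne hpq) (x.injective.ne hpr)
      (x.injective.ne hqr)
    exact Or.inr (TripleLevel.classify (x := x) (p := p) (q := q) (r := r) (i := i) (j := j)
      (k := k) ⟨hx, hpq, hpr, hqr, h1, h2, hsing, hvals, hij, hjk, hvar⟩).symm
  · exact Or.inl (exists_rectangle hpq hrs h1 h2 h3 hsing hvar)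

/-! ### Lengths and angles -/

theorem sum_swap_sub_mul {n : ℕ} {a b : Fin n} (hab : a ≠ b) (g : Fin n → ℝ) :
    ∑ v, (((Equiv.swap a b v : ℕ) : ℝ) - ((v : ℕ) : ℝ)) * g v =
      (((b : ℕ) : ℝ) - ((a : ℕ) : ℝ)) * (g a - g b) := by
  rw [← Finset.sum_subset (Finset.subset_univ {a, b}), Finset.sum_pair hab,
    Equiv.swap_apply_left, Equiv.swap_apply_right]
  · ring
  · intro v _ hv
    simp only [Finset.mem_insert, Finset.mem_singleton, not_or] at hv
    rw [Equiv.swap_apply_of_ne_of_ne hv.1 hv.2, sub_self, zero_mul]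

/-- Reindexed by values instead of positions, the first difference is `(b - a)(e_a - e_b)`, whatever
`π` is. -/
theorem inner_permPoint_sub {n : ℕ} (π : Equiv.Perm (Fin n)) {a b : Fin n} (hab : a ≠ b)
    (d e : Fin n) :
    inner ℝ (permPoint (Equiv.swap a b * π) - permPoint π)
      (permPoint (Equiv.swap d e * π) - permPoint π) =
    (((b : ℕ) : ℝ) - ((a : ℕ) : ℝ)) * ((((Equiv.swap d e a : ℕ) : ℝ) - ((a : ℕ) : ℝ)) -
      (((Equiv.swap d e b : ℕ) : ℝ) - ((b : ℕ) : ℝ))) := by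
  rw [← sum_swap_sub_mul hab fun v => (((Equiv.swap d e v : ℕ) : ℝ) - ((v : ℕ) : ℝ)),
    ← Equiv.sum_comp π, PiLp.inner_apply]
  refine Finset.sum_congr rfl fun p _ => ?_
  simp [permPoint]
  ring

theorem norm_permPoint_sub {n : ℕ} (π : Equiv.Perm (Fin n)) {a b : Fin n} (hab : a ≠ b) :
    ‖permPoint (Equiv.swap a b * π) - permPoint π‖ =
      √2 * |((a : ℕ) : ℝ) - ((b : ℕ) : ℝ)| := by
  rw [norm_eq_sqrt_real_inner, inner_permPoint_sub π hab, Equiv.swap_apply_left,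
    Equiv.swap_apply_right, ← Real.sqrt_sq_eq_abs, ← Real.sqrt_mul (by norm_num)]
  congr 1
  ring

/-- The inner product is `(a - b)(a - d)` and the lengths are `√2 |a - b|` and `√2 |a - d|`. So the
cosine is `1/2` or `-1/2`, according to whether `b` and `d` lie on the same side of `a`. -/
theorem angle_permPoint {n : ℕ} (π : Equiv.Perm (Fin n)) {a b d : Fin n} (hab : a ≠ b)
    (had : a ≠ d) (hbd : b ≠ d) :
    ∠ (permPoint (Equiv.swap a b * π)) (permPoint π) (permPoint (Equiv.swap a d * π)) =
      Real.arccos ((((a : ℕ) : ℝ) - ((b : ℕ) : ℝ)) * (((a : ℕ) : ℝ) - ((d : ℕ) : ℝ)) /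
        |(((a : ℕ) : ℝ) - ((b : ℕ) : ℝ)) * (((a : ℕ) : ℝ) - ((d : ℕ) : ℝ))| / 2) := by
  rw [EuclideanGeometry.angle, InnerProductGeometry.angle, vsub_eq_sub, vsub_eq_sub,
    inner_permPoint_sub π hab, norm_permPoint_sub π hab, norm_permPoint_sub π had,
    Equiv.swap_apply_left, Equiv.swap_apply_of_ne_of_ne hab.symm hbd, div_div, abs_mul]
  congr 2
  · ring
  · have : √2 * √2 = 2 := Real.mul_self_sqrt (by norm_num)
    linear_combination (|((a : ℕ) : ℝ) - ((b : ℕ) : ℝ)| * |((a : ℕ) : ℝ) - ((d : ℕ) : ℝ)|) * this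

theorem angle_permPoint_of_pos {n : ℕ} (π : Equiv.Perm (Fin n)) {a b d : Fin n} (hbd : b ≠ d)
    (h : (a < b ∧ a < d) ∨ (b < a ∧ d < a)) :
    ∠ (permPoint (Equiv.swap a b * π)) (permPoint π) (permPoint (Equiv.swap a d * π)) =
      Real.pi / 3 := by
  have hpos : 0 < (((a : ℕ) : ℝ) - ((b : ℕ) : ℝ)) * (((a : ℕ) : ℝ) - ((d : ℕ) : ℝ)) := by
    rcases h with ⟨h1, h2⟩ | ⟨h1, h2⟩
    · exact mul_pos_of_neg_of_neg (sub_neg.2 (by exact_mod_cast h1))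
        (sub_neg.2 (by exact_mod_cast h2))
    · exact mul_pos (sub_pos.2 (by exact_mod_cast h1)) (sub_pos.2 (by exact_mod_cast h2))
  rw [angle_permPoint π (by rintro rfl; simp at hpos) (by rintro rfl; simp at hpos) hbd,
    abs_of_pos hpos, div_self hpos.ne', ← Real.cos_pi_div_three, Real.arccos_cos]
  · positivity
  · linarith [Real.pi_pos]

theorem angle_permPoint_of_neg {n : ℕ} (π : Equiv.Perm (Fin n)) {a b d : Fin n}
    (h : (b < a ∧ a < d) ∨ (d < a ∧ a < b)) :
    ∠ (permPoint (Equiv.swap a b * π)) (permPoint π) (permPoint (Equiv.swap a d * π)) =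
      2 * Real.pi / 3 := by
  have hneg : (((a : ℕ) : ℝ) - ((b : ℕ) : ℝ)) * (((a : ℕ) : ℝ) - ((d : ℕ) : ℝ)) < 0 := by
    rcases h with ⟨h1, h2⟩ | ⟨h1, h2⟩
    · exact mul_neg_of_pos_of_neg (sub_pos.2 (by exact_mod_cast h1))
        (sub_neg.2 (by exact_mod_cast h2))
    · exact mul_neg_of_neg_of_pos (sub_neg.2 (by exact_mod_cast h2))
        (sub_pos.2 (by exact_mod_cast h1))
  have hbd : b ≠ d := by
    rintro rfl
    exact absurd hneg (not_lt.2 (mul_self_nonneg _))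
  rw [angle_permPoint π (by rintro rfl; simp at hneg) (by rintro rfl; simp at hneg) hbd,
    abs_of_neg hneg, div_neg, div_self hneg.ne,
    show (-1 / 2 : ℝ) = Real.cos (Real.pi - Real.pi / 3) by
      rw [Real.cos_pi_sub, Real.cos_pi_div_three]; ring, Real.arccos_cos]
  · ring
  · linarith [Real.pi_pos]
  · linarith [Real.pi_pos]

theorem angle_permPoint_of_disjoint {n : ℕ} (π : Equiv.Perm (Fin n)) {a b d e : Fin n}
    (hab : a ≠ b) (had : a ≠ d) (hae : a ≠ e) (hbd : b ≠ d) (hbe : b ≠ e) :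
    ∠ (permPoint (Equiv.swap a b * π)) (permPoint π) (permPoint (Equiv.swap d e * π)) =
      Real.pi / 2 := by
  rw [EuclideanGeometry.angle, ← InnerProductGeometry.inner_eq_zero_iff_angle_eq_pi_div_two,
    vsub_eq_sub, vsub_eq_sub, inner_permPoint_sub π hab, Equiv.swap_apply_of_ne_of_ne had hae,
    Equiv.swap_apply_of_ne_of_ne hbd hbe]
  ring

theorem angleAt_eq {n m : ℕ} [NeZero m] {v : Fin m → Equiv.Perm (Fin n)} (t : Fin m)
    {a b d e : Fin n} (h1 : v t = Equiv.swap a b * v (t - 1))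
    (h2 : v (t + 1) = Equiv.swap d e * v t) :
    angleAt v t = ∠ (permPoint (Equiv.swap a b * v t)) (permPoint (v t))
      (permPoint (Equiv.swap d e * v t)) := by
  rw [angleAt, h2]
  congr 2
  rw [h1, ← mul_assoc, Equiv.swap_mul_self, one_mul]

/-! ### Edges inside a face -/

theorem finrank_directionSpan_pair {n : ℕ} {π σ : Equiv.Perm (Fin n)} (h : π ≠ σ) :
    Module.finrank ℝ (directionSpan {π, σ}) = 1 := by
  rw [directionSpan, Set.image_pair, vectorSpan_eq_span_vsub_set_right ℝ (Set.mem_insert _ _),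
    Set.image_pair, vsub_self, Submodule.span_insert_zero]
  exact finrank_span_singleton (vsub_ne_zero.2 fun h' => h (permPoint_injective h'.symm))

/-- The edges of a face of the bridge polytope are its segments exposed by a functional. -/
theorem isEdge_of_weight {n : ℕ} {J : Finset (Fin n)} {c c₂ : Fin n → ℝ}
    {π σ : Equiv.Perm (Fin n)} (hπ : π ∈ maximizers J c) (hσ : σ ∈ maximizers J c) (hne : π ≠ σ)
    (heq : weight c₂ π = weight c₂ σ)
    (hlt : ∀ τ ∈ maximizers J c, τ ≠ π → τ ≠ σ → weight c₂ τ < weight c₂ π) :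
    IsFaceOfDim 1 (bridgePolytope J) (segment ℝ (permPoint π) (permPoint σ)) ∧
      segment ℝ (permPoint π) (permPoint σ) ⊆ convexHull ℝ (permPoint '' maximizers J c) := by
  have hle : ∀ τ ∈ maximizers J c, weight c₂ τ ≤ weight c₂ π := by
    intro τ hτ
    by_cases h1 : τ = π
    · rw [h1]
    by_cases h2 : τ = σ
    · rw [h2, heq]
    · exact (hlt τ hτ h1 h2).le
  refine ⟨isFaceOfDim_iff.2 ?_, ?_⟩
  · obtain ⟨c', hc', -⟩ := exists_maximizers_eq J c c₂
    have hpair : maximizers J c' = {π, σ} := by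
      rw [hc']
      ext τ
      constructor
      · rintro ⟨hτ, hmax⟩
        by_contra hcon
        simp only [Set.mem_insert_iff, Set.mem_singleton_iff, not_or] at hcon
        exact absurd (hmax π hπ) (not_le.2 (hlt τ hτ hcon.1 hcon.2))
      · rintro (rfl | rfl)
        · exact ⟨hπ, hle⟩
        · exact ⟨hσ, fun ρ hρ => heq ▸ hle ρ hρ⟩
    refine ⟨c', ?_, ?_⟩
    · rw [hpair, Set.image_pair, convexHull_pair]
    · rw [hpair, finrank_directionSpan_pair hne]
  · rw [← convexHull_pair]
    refine convexHull_mono ?_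
    rintro _ (rfl | rfl)
    exacts [⟨π, hπ, rfl⟩, ⟨σ, hσ, rfl⟩]

/-- This gives the two obstructions used against diagonals: the ends of an edge differ by a
transposition, and some functional is strictly larger on them than on the other vertices of the
face. -/
theorem exists_of_isEdge {n : ℕ} {J : Finset (Fin n)} {c : Fin n → ℝ}
    {E : Set (EuclideanSpace ℝ (Fin n))} (hE : IsFaceOfDim 1 (bridgePolytope J) E)
    (hsub : E ⊆ convexHull ℝ (permPoint '' maximizers J c)) :
    ∃ π ∈ maximizers J c, ∃ σ ∈ maximizers J c, ∃ (c₂ : Fin n → ℝ) (p q : Fin n), p ≠ q ∧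
      σ = π * Equiv.swap p q ∧ E = segment ℝ (permPoint π) (permPoint σ) ∧
      weight c₂ π = weight c₂ σ ∧
      ∀ τ ∈ maximizers J c, τ ≠ π → τ ≠ σ → weight c₂ τ < weight c₂ π := by
  obtain ⟨c₂, rfl, hd⟩ := isFaceOfDim_iff.1 hE
  obtain ⟨π, p, q, hpq, hmax⟩ := exists_maximizers_eq_pair hd
  have hmem : ∀ τ ∈ maximizers J c₂, τ ∈ maximizers J c := by
    intro τ hτ
    have h1 := hsub (subset_convexHull ℝ _ ⟨τ, hτ, rfl⟩)
    rw [← toExposed_bridgePolytope] at h1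
    exact (permPoint_mem_toExposed_iff hτ.1).1 h1
  have hπ : π ∈ maximizers J c₂ := by rw [hmax]; exact Set.mem_insert _ _
  have hσ : π * Equiv.swap p q ∈ maximizers J c₂ := by
    rw [hmax]; exact Set.mem_insert_of_mem _ rfl
  refine ⟨π, hmem _ hπ, _, hmem _ hσ, c₂, p, q, hpq, rfl, ?_, ?_, ?_⟩
  · rw [hmax, Set.image_pair, convexHull_pair]
  · exact le_antisymm (hσ.2 π hπ.1) (hπ.2 _ hσ.1)
  · intro τ hτ h1 h2
    refine lt_of_le_of_ne (hπ.2 τ hτ.1) fun h => ?_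
    have : τ ∈ maximizers J c₂ := mem_maximizers_of_eqOn hπ hτ.1 h
    rw [hmax] at this
    rcases this with h | h
    · exact h1 h
    · exact h2 h

theorem weight_single {n : ℕ} (s : Fin n) (a : ℝ) (π : Equiv.Perm (Fin n)) :
    weight (Pi.single s a) π = a * ((π s : ℕ) : ℝ) := by
  rw [weight, Finset.sum_eq_single s]
  · rw [Pi.single_eq_same]
  · intro p _ hp
    rw [Pi.single_eq_of_ne hp, zero_mul]
  · simp

/-- A criterion for a face to be a labelled polygon, in which every side is exposed by a coordinate
and every exposed diagonal is a side. -/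
theorem isLabelledPolygon_of {n m : ℕ} [NeZero m] {J : Finset (Fin n)} {c : Fin n → ℝ}
    {v : Fin m → Equiv.Perm (Fin n)} {lab : Fin m → Fin n × Fin n}
    (hV : maximizers J c = Set.range v) (hinj : Function.Injective v)
    (hne : ∀ t, (lab t).1 ≠ (lab t).2)
    (hlab : ∀ t, v (t + 1) = Equiv.swap (lab t).1 (lab t).2 * v t)
    (hside : ∀ t, ∃ (s : Fin n) (a : ℝ), a * ((v t s : ℕ) : ℝ) = a * ((v (t + 1) s : ℕ) : ℝ) ∧
      ∀ u, u ≠ t → u ≠ t + 1 → a * ((v u s : ℕ) : ℝ) < a * ((v t s : ℕ) : ℝ))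
    (hdiag : ∀ t u (c₂ : Fin n → ℝ) (a b : Fin n), a ≠ b → v u = v t * Equiv.swap a b →
      weight c₂ (v t) = weight c₂ (v u) →
      (∀ w, w ≠ t → w ≠ u → weight c₂ (v w) < weight c₂ (v t)) → u = t + 1 ∨ t = u + 1) :
    IsLabelledPolygon J (convexHull ℝ (permPoint '' maximizers J c)) v lab := by
  have himage : permPoint '' maximizers J c = Set.range fun t => permPoint (v t) := by
    rw [hV, ← Set.range_comp]; rfl
  have hmem : ∀ t, v t ∈ maximizers J c := fun t => by rw [hV]; exact ⟨t, rfl⟩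
  have hsucc : ∀ t, v t ≠ v (t + 1) := by
    intro t h
    rw [hlab t] at h
    have h' := right_eq_mul.1 h
    exact hne t (Equiv.swap_eq_one_iff.1 h')
  refine ⟨fun t => (hmem t).1, hinj, by rw [himage], ?_, fun E => ⟨?_, ?_⟩, hne, hlab, ?_⟩
  · rw [extremePoints_convexHull_permPoint, himage]
  · rintro ⟨hE, hsub⟩
    obtain ⟨π, hπ, σ, hσ, c₂, p, q, hpq, hsw, rfl, heq, hlt⟩ := exists_of_isEdge hE hsub
    rw [hV] at hπ hσ
    obtain ⟨t, rfl⟩ := hπ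
    obtain ⟨u, rfl⟩ := hσ
    rcases hdiag t u c₂ p q hpq hsw heq fun w h1 h2 =>
        hlt _ (hmem w) (hinj.ne h1) (hinj.ne h2) with rfl | rfl
    · exact ⟨t, rfl⟩
    · exact ⟨u, segment_symm _ _ _⟩
  · rintro ⟨t, rfl⟩
    obtain ⟨s, a, heq, hlt⟩ := hside t
    refine isEdge_of_weight (c₂ := Pi.single s a) (hmem t) (hmem _) (hsucc t)
      (by rw [weight_single, weight_single, heq]) fun τ hτ h1 h2 => ?_
    rw [hV] at hτ
    obtain ⟨u, rfl⟩ := hτ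
    rw [weight_single, weight_single]
    exact hlt u (fun h => h1 (by rw [h])) (fun h => h2 (by rw [h]))
  · intro t
    rw [hlab t, dist_comm, dist_eq_norm, norm_permPoint_sub _ (hne t)]

/-- Two permutations that differ in three places do not differ by a transposition. -/
theorem false_of_three_ne {n : ℕ} {π σ : Equiv.Perm (Fin n)} {a b : Fin n}
    (h : σ = π * Equiv.swap a b) {p q r : Fin n} (hpq : p ≠ q) (hpr : p ≠ r) (hqr : q ≠ r)
    (hp : σ p ≠ π p) (hq : σ q ≠ π q) (hr : σ r ≠ π r) : False := by
  have key : ∀ s, σ s ≠ π s → s = a ∨ s = b := by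
    intro s hs
    by_contra hcon
    push Not at hcon
    exact hs (by rw [h, Equiv.Perm.mul_apply, Equiv.swap_apply_of_ne_of_ne hcon.1 hcon.2])
  rcases key p hp with rfl | rfl <;> rcases key q hq with rfl | rfl <;>
    rcases key r hr with rfl | rfl <;> contradiction

theorem ext_of_eqOn {n : ℕ} {x y z : Equiv.Perm (Fin n)} {p q r : Fin n}
    (hy : ∀ s, s ≠ p → s ≠ q → s ≠ r → y s = x s) (hz : ∀ s, s ≠ p → s ≠ q → s ≠ r → z s = x s)
    (hp : y p = z p) (hq : y q = z q) (hr : y r = z r) : y = z := by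
  ext1 s
  by_cases h1 : s = p
  · rw [h1, hp]
  by_cases h2 : s = q
  · rw [h2, hq]
  by_cases h3 : s = r
  · rw [h3, hr]
  · rw [hy s h1 h2 h3, hz s h1 h2 h3]

theorem val_lt {n : ℕ} {a b : Fin n} (h : a < b) : ((a : ℕ) : ℝ) < ((b : ℕ) : ℝ) := by
  exact_mod_cast h

/-! ### The rectangle -/

theorem isSquareFace_of {n : ℕ} {J : Finset (Fin n)} {c : Fin n → ℝ} {x : Equiv.Perm (Fin n)}
    {p q r s : Fin n} (h1 : x p < x q) (h2 : x q < x r) (h3 : x r < x s)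
    (hV : maximizers J c =
      {x, x * Equiv.swap p q, x * Equiv.swap p q * Equiv.swap r s, x * Equiv.swap r s}) :
    IsSquareFace J (convexHull ℝ (permPoint '' maximizers J c)) := by
  obtain ⟨i, hi⟩ : ∃ i, x p = i := ⟨_, rfl⟩
  obtain ⟨j, hj⟩ : ∃ j, x q = j := ⟨_, rfl⟩
  obtain ⟨k, hk⟩ : ∃ k, x r = k := ⟨_, rfl⟩
  obtain ⟨l, hl⟩ : ∃ l, x s = l := ⟨_, rfl⟩
  rw [hi, hj] at h1
  rw [hj, hk] at h2
  rw [hk, hl] at h3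
  have nij := h1.ne
  have njk := h2.ne
  have nkl := h3.ne
  have nik := (h1.trans h2).ne
  have njl := (h2.trans h3).ne
  have nil := (h1.trans (h2.trans h3)).ne
  have hpq : p ≠ q := by rintro rfl; exact nij (hi.symm.trans hj)
  have hpr : p ≠ r := by rintro rfl; exact nik (hi.symm.trans hk)
  have hqr : q ≠ r := by rintro rfl; exact njk (hj.symm.trans hk)
  set v : Fin 4 → Equiv.Perm (Fin n) := ![x, Equiv.swap i j * x,
    Equiv.swap k l * (Equiv.swap i j * x), Equiv.swap k l * x] with hv
  have tp : ∀ t, v t p = ![i, j, j, i] t := by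
    intro t
    fin_cases t <;>
      simp [hv, hi, Equiv.swap_apply_of_ne_of_ne, njk, nik, njl, nil]
  have tq : ∀ t, v t q = ![j, i, i, j] t := by
    intro t
    fin_cases t <;>
      simp [hv, hj, Equiv.swap_apply_of_ne_of_ne, njk, nik, njl, nil]
  have tr : ∀ t, v t r = ![k, k, l, l] t := by
    intro t
    fin_cases t <;>
      simp [hv, hk, Equiv.swap_apply_of_ne_of_ne, njk.symm, nik.symm]
  have hcomm : Equiv.swap k l * (Equiv.swap i j * x) = Equiv.swap i j * (Equiv.swap k l * x) := by
    rw [← mul_assoc, ← mul_assoc]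
    congr 1
    exact (Equiv.Perm.Disjoint.commute (Equiv.Perm.disjoint_swap_swap
      (by simp [nij, njk.symm, nkl, nik.symm, njl.symm, nil.symm]))).eq
  have hlab : ∀ t, v (t + 1) = Equiv.swap (![(i, j), (k, l), (i, j), (k, l)] t).1
      (![(i, j), (k, l), (i, j), (k, l)] t).2 * v t := by
    have inv : ∀ (a b : Fin n) (z : Equiv.Perm (Fin n)), Equiv.swap a b * (Equiv.swap a b * z) = z :=
      fun a b z => by rw [← mul_assoc, Equiv.swap_mul_self, one_mul]
    have l0 : v 1 = Equiv.swap i j * v 0 := rfl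
    have l1 : v 2 = Equiv.swap k l * v 1 := rfl
    have l2 : v 3 = Equiv.swap i j * v 2 := by
      change _ = Equiv.swap i j * (Equiv.swap k l * (Equiv.swap i j * x))
      rw [hcomm, inv]; rfl
    have l3 : v 0 = Equiv.swap k l * v 3 := (inv k l x).symm
    intro t
    fin_cases t
    exacts [l0, l1, l2, l3]
  have hrange : maximizers J c = Set.range v := by
    have e1 : x * Equiv.swap p q = Equiv.swap i j * x := by
      rw [Equiv.mul_swap_eq_swap_mul, hi, hj]
    have e2 : x * Equiv.swap r s = Equiv.swap k l * x := by
      rw [Equiv.mul_swap_eq_swap_mul, hk, hl]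
    rw [hV, e1, e2, mul_assoc, e2, ← hcomm, hv]
    simp only [Matrix.range_cons, Matrix.range_empty, Set.union_empty, Set.singleton_union]
  have c4 : ∀ t : Fin 4, t = 0 ∨ t = 1 ∨ t = 2 ∨ t = 3 := by decide
  have hij := val_lt h1
  have hkl := val_lt h3
  refine ⟨i, j, k, l, v, h1, h2, h3, isLabelledPolygon_of hrange ?_ ?_ hlab ?_ ?_, ?_⟩
  · intro t u htu
    have hp : ![i, j, j, i] t = ![i, j, j, i] u := by rw [← tp, ← tp, htu]
    have hr : ![k, k, l, l] t = ![k, k, l, l] u := by rw [← tr, ← tr, htu]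
    rcases c4 t with rfl | rfl | rfl | rfl <;> rcases c4 u with rfl | rfl | rfl | rfl <;>
      first | rfl | exact absurd hp nij | exact absurd hp nij.symm | exact absurd hr nkl |
        exact absurd hr nkl.symm
  · intro t
    rcases c4 t with rfl | rfl | rfl | rfl
    exacts [nij, nkl, nij, nkl]
  · intro t
    rcases c4 t with rfl | rfl | rfl | rfl
    -- On this side `r` carries `k` and on the opposite side the larger `l`, hence the negative
    -- sign.
    · refine ⟨r, -1, by rw [tr, tr]; rfl, fun u hu hu' => ?_⟩
      rw [tr, tr]
      rcases c4 u with rfl | rfl | rfl | rfl <;> simp at hu hu' ⊢ <;> exact h3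
    · refine ⟨p, 1, by rw [tp, tp]; rfl, fun u hu hu' => ?_⟩
      rw [tp, tp]
      rcases c4 u with rfl | rfl | rfl | rfl <;> simp at hu hu' ⊢ <;> exact h1
    · refine ⟨r, 1, by rw [tr, tr]; rfl, fun u hu hu' => ?_⟩
      rw [tr, tr]
      rcases c4 u with rfl | rfl | rfl | rfl <;> simp at hu hu' ⊢ <;> exact h3
    · refine ⟨p, -1, by rw [tp, tp]; rfl, fun u hu hu' => ?_⟩
      rw [tp, tp]
      rcases c4 u with rfl | rfl | rfl | rfl <;> simp at hu hu' ⊢ <;> exact h1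
  · intro t u c₂ a b hab hsw heq hlt
    have h3' := fun hp hq hr => false_of_three_ne hsw hpq hpr hqr hp hq hr
    have hvne : v u ≠ v t := by
      intro h
      rw [hsw] at h
      exact hab (Equiv.swap_eq_one_iff.1 (mul_eq_left.1 h))
    rw [tp, tp, tq, tq, tr, tr] at h3'
    rcases c4 t with rfl | rfl | rfl | rfl <;> rcases c4 u with rfl | rfl | rfl | rfl <;>
      first | exact Or.inl rfl | exact Or.inr rfl | exact absurd rfl hvne |
        (exfalso; refine h3' ?_ ?_ ?_ <;> simp [nij, nij.symm, nkl, nkl.symm])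
  · intro t
    rcases c4 t with rfl | rfl | rfl | rfl
    · rw [angleAt_eq 0 (a := k) (b := l) (hlab 3) (hlab 0)]
      exact angle_permPoint_of_disjoint _ nkl nik.symm njk.symm nil.symm njl.symm
    · rw [angleAt_eq 1 (a := i) (b := j) (hlab 0) (hlab 1)]
      exact angle_permPoint_of_disjoint _ nij nik nil njk njl
    · rw [angleAt_eq 2 (a := k) (b := l) (hlab 1) (hlab 2)]
      exact angle_permPoint_of_disjoint _ nkl nik.symm njk.symm nil.symm njl.symm
    · rw [angleAt_eq 3 (a := i) (b := j) (hlab 2) (hlab 3)]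
      exact angle_permPoint_of_disjoint _ nij nik nil njk njl

/-! ### The trapezoid -/

theorem isTrapezoidFace_of {n : ℕ} {J : Finset (Fin n)} {c : Fin n → ℝ} {x : Equiv.Perm (Fin n)}
    {p q r : Fin n} (h : (x p < x r ∧ x r < x q) ∨ (x q < x r ∧ x r < x p))
    (hV : ∀ z, z ∈ maximizers J c ↔ (∀ s, s ≠ p → s ≠ q → s ≠ r → z s = x s) ∧ z r ≠ x q) :
    IsTrapezoidFace J (convexHull ℝ (permPoint '' maximizers J c)) := by
  obtain ⟨i, hi⟩ : ∃ i, x p = i := ⟨_, rfl⟩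
  obtain ⟨k, hk⟩ : ∃ k, x q = k := ⟨_, rfl⟩
  obtain ⟨j, hj⟩ : ∃ j, x r = j := ⟨_, rfl⟩
  rw [hi, hj, hk] at h
  rw [hk] at hV
  have nij : i ≠ j := by rcases h with h | h; exacts [h.1.ne, h.2.ne']
  have njk : j ≠ k := by rcases h with h | h; exacts [h.2.ne, h.1.ne']
  have nik : i ≠ k := by
    rcases h with h | h
    exacts [(h.1.trans h.2).ne, (h.1.trans h.2).ne']
  have hpq : p ≠ q := by rintro rfl; exact nik (hi.symm.trans hk)
  have hpr : p ≠ r := by rintro rfl; exact nij (hi.symm.trans hj)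
  have hqr : q ≠ r := by rintro rfl; exact njk (hj.symm.trans hk)
  set v : Fin 4 → Equiv.Perm (Fin n) := ![x, Equiv.swap i k * x,
    Equiv.swap i j * (Equiv.swap i k * x),
    Equiv.swap j k * (Equiv.swap i j * (Equiv.swap i k * x))] with hv
  have tp : ∀ t, v t p = ![i, k, k, j] t := by
    intro t
    fin_cases t <;> simp [hv, hi, Equiv.swap_apply_of_ne_of_ne, njk.symm, nik.symm]
  have tq : ∀ t, v t q = ![k, i, j, k] t := by
    intro t
    fin_cases t <;> simp [hv, hk]
  have tr : ∀ t, v t r = ![j, j, i, i] t := by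
    intro t
    fin_cases t <;> simp [hv, hj, Equiv.swap_apply_of_ne_of_ne, nij, nij.symm, njk, nik]
  have toff : ∀ t s, s ≠ p → s ≠ q → s ≠ r → v t s = x s := by
    intro t s s1 s2 s3
    have e1 : x s ≠ i := hi ▸ x.injective.ne s1
    have e2 : x s ≠ k := hk ▸ x.injective.ne s2
    have e3 : x s ≠ j := hj ▸ x.injective.ne s3
    fin_cases t <;> simp [hv, Equiv.swap_apply_of_ne_of_ne, e1, e2, e3]
  have hlab : ∀ t, v (t + 1) = Equiv.swap (![(i, k), (i, j), (j, k), (i, j)] t).1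
      (![(i, k), (i, j), (j, k), (i, j)] t).2 * v t := by
    have l3 : v 0 = Equiv.swap i j * v 3 := by
      refine ext_of_eqOn (x := x) (toff 0) (fun s s1 s2 s3 => ?_) ?_ ?_ ?_
      · rw [Equiv.Perm.mul_apply, toff 3 s s1 s2 s3, Equiv.swap_apply_of_ne_of_ne
          (hi ▸ x.injective.ne s1) (hj ▸ x.injective.ne s3)]
      · rw [Equiv.Perm.mul_apply, tp, tp]; simp
      · rw [Equiv.Perm.mul_apply, tq, tq]
        simp [Equiv.swap_apply_of_ne_of_ne, nik.symm, njk.symm]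
      · rw [Equiv.Perm.mul_apply, tr, tr]; simp
    intro t
    fin_cases t
    exacts [rfl, rfl, rfl, l3]
  have c4 : ∀ t : Fin 4, t = 0 ∨ t = 1 ∨ t = 2 ∨ t = 3 := by decide
  have hrange : maximizers J c = Set.range v := by
    ext z
    rw [hV]
    constructor
    · rintro ⟨hz, hne⟩
      have hfind : ∀ t, v t p = z p → v t q = z q → v t r = z r → z ∈ Set.range v :=
        fun t a b d => ⟨t, ext_of_eqOn (toff t) hz a b d⟩
      have hp := apply_mem_of_eqOn hz
      have hq := apply_mem_of_eqOn (p := q) (q := r) (r := p) fun s a b d => hz s d a b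
      have hr := apply_mem_of_eqOn (p := r) (q := p) (r := q) fun s a b d => hz s b d a
      rw [hi, hj, hk] at hp hq hr
      have n1 := z.injective.ne hpq
      have n2 := z.injective.ne hpr
      have n3 := z.injective.ne hqr
      rcases hp with e1 | e1 | e1 <;> rcases hq with e2 | e2 | e2 <;>
        rcases hr with e3 | e3 | e3 <;>
        first | exact absurd (e1.trans e2.symm) n1 | exact absurd (e1.trans e3.symm) n2 |
          exact absurd (e2.trans e3.symm) n3 | exact absurd e3 hne |
          exact hfind 0 (by rw [tp, e1]; rfl) (by rw [tq, e2]; rfl) (by rw [tr, e3]; rfl) |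
          exact hfind 1 (by rw [tp, e1]; rfl) (by rw [tq, e2]; rfl) (by rw [tr, e3]; rfl) |
          exact hfind 2 (by rw [tp, e1]; rfl) (by rw [tq, e2]; rfl) (by rw [tr, e3]; rfl) |
          exact hfind 3 (by rw [tp, e1]; rfl) (by rw [tq, e2]; rfl) (by rw [tr, e3]; rfl)
    · rintro ⟨t, rfl⟩
      refine ⟨toff t, ?_⟩
      rw [tr]
      rcases c4 t with rfl | rfl | rfl | rfl
      exacts [njk, njk, nik, nik]
  have hreal : (((i : ℕ) : ℝ) < (j : ℕ) ∧ ((j : ℕ) : ℝ) < (k : ℕ)) ∨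
      (((k : ℕ) : ℝ) < (j : ℕ) ∧ ((j : ℕ) : ℝ) < (i : ℕ)) :=
    h.imp (fun h => ⟨val_lt h.1, val_lt h.2⟩) (fun h => ⟨val_lt h.1, val_lt h.2⟩)
  refine ⟨i, j, k, v, h, isLabelledPolygon_of hrange ?_ ?_ hlab ?_ ?_, ?_, ?_, ?_, ?_⟩
  · intro t u htu
    have hp : ![i, k, k, j] t = ![i, k, k, j] u := by rw [← tp, ← tp, htu]
    have hr : ![j, j, i, i] t = ![j, j, i, i] u := by rw [← tr, ← tr, htu]
    rcases c4 t with rfl | rfl | rfl | rfl <;> rcases c4 u with rfl | rfl | rfl | rfl <;>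
      first | rfl | exact absurd hp nij | exact absurd hp nij.symm | exact absurd hp nik |
        exact absurd hp nik.symm | exact absurd hp njk | exact absurd hp njk.symm |
        exact absurd hr nij | exact absurd hr nij.symm
  · intro t
    rcases c4 t with rfl | rfl | rfl | rfl
    exacts [nik, nij, njk, nij]
  · intro t
    rcases c4 t with rfl | rfl | rfl | rfl
    -- The difference of two values serves as coefficient because its sign follows the orientation,
    -- covering `i < j < k` and `k < j < i` at once.
    · refine ⟨r, (j : ℕ) - (i : ℕ), by rw [tr, tr]; rfl, fun u hu hu' => ?_⟩
      rw [tr, tr]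
      rcases c4 u with rfl | rfl | rfl | rfl <;> simp at hu hu' ⊢ <;>
        rcases hreal with hh | hh <;> nlinarith [hh.1, hh.2]
    · refine ⟨p, (k : ℕ) - (i : ℕ), by rw [tp, tp]; rfl, fun u hu hu' => ?_⟩
      rw [tp, tp]
      rcases c4 u with rfl | rfl | rfl | rfl <;> simp at hu hu' ⊢ <;>
        rcases hreal with hh | hh <;> nlinarith [hh.1, hh.2]
    · refine ⟨r, (i : ℕ) - (j : ℕ), by rw [tr, tr]; rfl, fun u hu hu' => ?_⟩
      rw [tr, tr]
      rcases c4 u with rfl | rfl | rfl | rfl <;> simp at hu hu' ⊢ <;>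
        rcases hreal with hh | hh <;> nlinarith [hh.1, hh.2]
    · refine ⟨q, (k : ℕ) - (i : ℕ), by rw [tq, tq]; rfl, fun u hu hu' => ?_⟩
      rw [tq, tq]
      rcases c4 u with rfl | rfl | rfl | rfl <;> simp at hu hu' ⊢ <;>
        rcases hreal with hh | hh <;> nlinarith [hh.1, hh.2]
  · intro t u c₂ a b hab hsw heq hlt
    have h3' := fun hp hq hr => false_of_three_ne hsw hpq hpr hqr hp hq hr
    have hvne : v u ≠ v t := by
      intro h
      rw [hsw] at h
      exact hab (Equiv.swap_eq_one_iff.1 (mul_eq_left.1 h))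
    rw [tp, tp, tq, tq, tr, tr] at h3'
    rcases c4 t with rfl | rfl | rfl | rfl <;> rcases c4 u with rfl | rfl | rfl | rfl <;>
      first | exact Or.inl rfl | exact Or.inr rfl | exact absurd rfl hvne |
        (exfalso; refine h3' ?_ ?_ ?_ <;> simp [nij, nij.symm, njk, njk.symm, nik, nik.symm])
  · rw [angleAt_eq 0 (a := i) (b := j) (hlab 3) (hlab 0)]
    refine angle_permPoint_of_pos _ njk (h.imp (fun h => ?_) fun h => ?_)
    exacts [⟨h.1, h.1.trans h.2⟩, ⟨h.2, h.1.trans h.2⟩]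
  · rw [angleAt_eq 1 (a := i) (b := k) (hlab 0) (hlab 1)]
    refine angle_permPoint_of_pos _ njk.symm (h.imp (fun h => ?_) fun h => ?_)
    exacts [⟨h.1.trans h.2, h.1⟩, ⟨h.1.trans h.2, h.2⟩]
  · rw [angleAt_eq 2 (a := j) (b := i) (by rw [Equiv.swap_comm]; exact hlab 1) (hlab 2)]
    exact angle_permPoint_of_neg _ (h.imp (fun h => h) fun h => h)
  · rw [angleAt_eq 3 (a := j) (b := k) (hlab 2) (d := j) (e := i)
      (by rw [Equiv.swap_comm]; exact hlab 3)]
    exact angle_permPoint_of_neg _ h.symm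

/-! ### The hexagon -/

/-- Equality at the two opposite vertices gives `α = γ`, while the two neighbours of the first give
`α < β < γ`. -/
theorem false_of_opposite_maximal {α β γ i j k M : ℝ} (hij : i < j) (hjk : j < k)
    (h1 : α * i + β * j + γ * k = M) (h2 : α * k + β * j + γ * i = M)
    (h3 : α * j + β * i + γ * k < M) (h4 : α * i + β * k + γ * j < M) : False := by
  have e1 : (α - γ) * (k - i) = 0 := by linarith
  have e2 : α = γ := by
    rcases mul_eq_zero.1 e1 with h | h <;> linarith
  have e3 : (β - α) * (j - i) > 0 := by linarith
  have e4 : (γ - β) * (k - j) > 0 := by linarith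
  have e5 := (pos_iff_pos_of_mul_pos e3).2 (by linarith)
  have e6 := (pos_iff_pos_of_mul_pos e4).2 (by linarith)
  linarith

theorem hexagon_false_of_opposite {n : ℕ} {x : Equiv.Perm (Fin n)} {p q r i j k : Fin n}
    {v : Fin 6 → Equiv.Perm (Fin n)} (hpq : p ≠ q) (hpr : p ≠ r) (hqr : q ≠ r) (h1 : i < j)
    (h2 : j < k) (hi : x p = i) (hj : x q = j) (hk : x r = k)
    (tp : ∀ t, v t p = ![i, j, k, k, j, i] t) (tq : ∀ t, v t q = ![j, i, i, j, k, k] t)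
    (tr : ∀ t, v t r = ![k, k, j, i, i, j] t)
    (toff : ∀ t s, s ≠ p → s ≠ q → s ≠ r → v t s = x s) {t : Fin 6} {c₂ : Fin n → ℝ}
    (heq : weight c₂ (v t) = weight c₂ (v (t + 3)))
    (hlt : ∀ w, w ≠ t → w ≠ t + 3 → weight c₂ (v w) < weight c₂ (v t)) : False := by
  obtain ⟨C, hw⟩ : ∃ C : ℝ, ∀ t, weight c₂ (v t) = C +
      (c₂ p * ((![i, j, k, k, j, i] t : ℕ) : ℝ) + c₂ q * ((![j, i, i, j, k, k] t : ℕ) : ℝ) +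
        c₂ r * ((![k, k, j, i, i, j] t : ℕ) : ℝ)) := by
    refine ⟨weight c₂ x - (c₂ p * (i : ℕ) + c₂ q * (j : ℕ) + c₂ r * (k : ℕ)), fun t => ?_⟩
    rw [weight_eq_add_of_eqOn c₂ (x := x) {p, q, r}, Finset.sum_insert (by simp [hpq, hpr]),
      Finset.sum_pair hqr, tp, tq, tr, hi, hj, hk]
    · ring
    · intro s hs
      simp only [Finset.mem_insert, Finset.mem_singleton, not_or] at hs
      exact toff t s hs.1 hs.2.1 hs.2.2
  have w0 : weight c₂ (v 0) = C + (c₂ p * (i : ℕ) + c₂ q * (j : ℕ) + c₂ r * (k : ℕ)) := hw 0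
  have w1 : weight c₂ (v 1) = C + (c₂ p * (j : ℕ) + c₂ q * (i : ℕ) + c₂ r * (k : ℕ)) := hw 1
  have w2 : weight c₂ (v 2) = C + (c₂ p * (k : ℕ) + c₂ q * (i : ℕ) + c₂ r * (j : ℕ)) := hw 2
  have w3 : weight c₂ (v 3) = C + (c₂ p * (k : ℕ) + c₂ q * (j : ℕ) + c₂ r * (i : ℕ)) := hw 3
  have w4 : weight c₂ (v 4) = C + (c₂ p * (j : ℕ) + c₂ q * (k : ℕ) + c₂ r * (i : ℕ)) := hw 4
  have w5 : weight c₂ (v 5) = C + (c₂ p * (i : ℕ) + c₂ q * (k : ℕ) + c₂ r * (j : ℕ)) := hw 5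
  have hsucc : weight c₂ (v (t + 1)) < weight c₂ (v t) := hlt _ (by clear * -; revert t; decide)
    (by clear * -; revert t; decide)
  have hpred : weight c₂ (v (t - 1)) < weight c₂ (v t) := hlt _ (by clear * -; revert t; decide)
    (by clear * -; revert t; decide)
  -- For `t` equal to 3, 4 or 5 the diagonal is read from its other end `t + 3`, whose neighbours
  -- are `t + 4` and `t + 2`.
  have hsucc' : weight c₂ (v (t + 4)) < weight c₂ (v t) := hlt _ (by clear * -; revert t; decide)
    (by clear * -; revert t; decide)
  have hpred' : weight c₂ (v (t + 2)) < weight c₂ (v t) := hlt _ (by clear * -; revert t; decide)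
    (by clear * -; revert t; decide)
  have c6 : t = 0 ∨ t = 1 ∨ t = 2 ∨ t = 3 ∨ t = 4 ∨ t = 5 := by clear * -; revert t; decide
  have A := fun M => false_of_opposite_maximal (α := c₂ p) (β := c₂ q) (γ := c₂ r) (M := M)
    (val_lt h1) (val_lt h2)
  have B := fun M => false_of_opposite_maximal (α := c₂ q) (β := c₂ p) (γ := c₂ r) (M := M)
    (val_lt h1) (val_lt h2)
  have D := fun M => false_of_opposite_maximal (α := c₂ q) (β := c₂ r) (γ := c₂ p) (M := M)
    (val_lt h1) (val_lt h2)
  rcases c6 with rfl | rfl | rfl | rfl | rfl | rfl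
  · change weight c₂ (v 0) = weight c₂ (v 3) at heq
    change weight c₂ (v 1) < _ at hsucc
    change weight c₂ (v 5) < _ at hpred
    exact A (weight c₂ (v 0) - C) (by linarith) (by linarith) (by linarith) (by linarith)
  · change weight c₂ (v 1) = weight c₂ (v 4) at heq
    change weight c₂ (v 2) < _ at hsucc
    change weight c₂ (v 0) < _ at hpred
    exact B (weight c₂ (v 1) - C) (by linarith) (by linarith) (by linarith) (by linarith)
  · change weight c₂ (v 2) = weight c₂ (v 5) at heq
    change weight c₂ (v 3) < _ at hsucc
    change weight c₂ (v 1) < _ at hpred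
    exact D (weight c₂ (v 2) - C) (by linarith) (by linarith) (by linarith) (by linarith)
  · change weight c₂ (v 3) = weight c₂ (v 0) at heq
    change weight c₂ (v 1) < _ at hsucc'
    change weight c₂ (v 5) < _ at hpred'
    exact A (weight c₂ (v 0) - C) (by linarith) (by linarith) (by linarith) (by linarith)
  · change weight c₂ (v 4) = weight c₂ (v 1) at heq
    change weight c₂ (v 2) < _ at hsucc'
    change weight c₂ (v 0) < _ at hpred'
    exact B (weight c₂ (v 1) - C) (by linarith) (by linarith) (by linarith) (by linarith)
  · change weight c₂ (v 5) = weight c₂ (v 2) at heq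
    change weight c₂ (v 3) < _ at hsucc'
    change weight c₂ (v 1) < _ at hpred'
    exact D (weight c₂ (v 2) - C) (by linarith) (by linarith) (by linarith) (by linarith)

theorem exists_hexagon_vertices {n : ℕ} {x : Equiv.Perm (Fin n)} {p q r i j k : Fin n}
    (hi : x p = i) (hj : x q = j) (hk : x r = k) (nij : i ≠ j) (njk : j ≠ k) (nik : i ≠ k) :
    ∃ v : Fin 6 → Equiv.Perm (Fin n), (∀ t, v t p = ![i, j, k, k, j, i] t) ∧
      (∀ t, v t q = ![j, i, i, j, k, k] t) ∧ (∀ t, v t r = ![k, k, j, i, i, j] t) ∧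
      (∀ t s, s ≠ p → s ≠ q → s ≠ r → v t s = x s) ∧
      (∀ t, v (t + 1) = Equiv.swap (![(i, j), (j, k), (i, j), (j, k), (i, j), (j, k)] t).1
        (![(i, j), (j, k), (i, j), (j, k), (i, j), (j, k)] t).2 * v t) ∧
      ∀ z : Equiv.Perm (Fin n),
        (∀ s, s ≠ p → s ≠ q → s ≠ r → z s = x s) ↔ z ∈ Set.range v := by
  have hpq : p ≠ q := by rintro rfl; exact nij (hi.symm.trans hj)
  have hpr : p ≠ r := by rintro rfl; exact nik (hi.symm.trans hk)
  have hqr : q ≠ r := by rintro rfl; exact njk (hj.symm.trans hk)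
  obtain ⟨v, hv⟩ : ∃ v : Fin 6 → Equiv.Perm (Fin n), v = ![x, Equiv.swap i j * x,
    Equiv.swap j k * (Equiv.swap i j * x),
    Equiv.swap i j * (Equiv.swap j k * (Equiv.swap i j * x)),
    Equiv.swap j k * (Equiv.swap i j * (Equiv.swap j k * (Equiv.swap i j * x))),
    Equiv.swap i j * (Equiv.swap j k * (Equiv.swap i j * (Equiv.swap j k *
      (Equiv.swap i j * x))))] := ⟨_, rfl⟩
  have tp : ∀ t, v t p = ![i, j, k, k, j, i] t := by
    intro t
    fin_cases t <;> simp [hv, hi, Equiv.swap_apply_of_ne_of_ne, njk.symm, nik.symm]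
  have tq : ∀ t, v t q = ![j, i, i, j, k, k] t := by
    intro t
    fin_cases t <;> simp [hv, hj, Equiv.swap_apply_of_ne_of_ne, nij, nik, njk.symm, nik.symm]
  have tr : ∀ t, v t r = ![k, k, j, i, i, j] t := by
    intro t
    fin_cases t <;> simp [hv, hk, Equiv.swap_apply_of_ne_of_ne, nij, nik, njk.symm, nik.symm]
  have toff : ∀ t s, s ≠ p → s ≠ q → s ≠ r → v t s = x s := by
    intro t s s1 s2 s3
    have e1 : x s ≠ i := hi ▸ x.injective.ne s1
    have e2 : x s ≠ j := hj ▸ x.injective.ne s2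
    have e3 : x s ≠ k := hk ▸ x.injective.ne s3
    fin_cases t <;> simp [hv, Equiv.swap_apply_of_ne_of_ne, e1, e2, e3]
  have hlab : ∀ t, v (t + 1) = Equiv.swap (![(i, j), (j, k), (i, j), (j, k), (i, j), (j, k)] t).1
      (![(i, j), (j, k), (i, j), (j, k), (i, j), (j, k)] t).2 * v t := by
    have l5 : v 0 = Equiv.swap j k * v 5 := by
      refine ext_of_eqOn (x := x) (toff 0) (fun s s1 s2 s3 => ?_) ?_ ?_ ?_
      · rw [Equiv.Perm.mul_apply, toff 5 s s1 s2 s3, Equiv.swap_apply_of_ne_of_ne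
          (hj ▸ x.injective.ne s2) (hk ▸ x.injective.ne s3)]
      · rw [Equiv.Perm.mul_apply, tp, tp]
        simp [Equiv.swap_apply_of_ne_of_ne, nij, nik]
      · rw [Equiv.Perm.mul_apply, tq, tq]; simp
      · rw [Equiv.Perm.mul_apply, tr, tr]; simp
    intro t
    fin_cases t
    exacts [by rw [hv]; rfl, by rw [hv]; rfl, by rw [hv]; rfl, by rw [hv]; rfl, by rw [hv]; rfl, l5]
  have hrange : ∀ z : Equiv.Perm (Fin n),
      (∀ s, s ≠ p → s ≠ q → s ≠ r → z s = x s) ↔ z ∈ Set.range v := by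
    intro z
    constructor
    · intro hz
      have hfind : ∀ t, v t p = z p → v t q = z q → v t r = z r → z ∈ Set.range v :=
        fun t a b d => ⟨t, ext_of_eqOn (toff t) hz a b d⟩
      have hp := apply_mem_of_eqOn hz
      have hq := apply_mem_of_eqOn (p := q) (q := r) (r := p) fun s a b d => hz s d a b
      have hr := apply_mem_of_eqOn (p := r) (q := p) (r := q) fun s a b d => hz s b d a
      rw [hi, hj, hk] at hp hq hr
      have n1 := z.injective.ne hpq
      have n2 := z.injective.ne hpr
      have n3 := z.injective.ne hqr
      rcases hp with e1 | e1 | e1 <;> rcases hq with e2 | e2 | e2 <;>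
        rcases hr with e3 | e3 | e3 <;>
        first | exact absurd (e1.trans e2.symm) n1 | exact absurd (e1.trans e3.symm) n2 |
          exact absurd (e2.trans e3.symm) n3 |
          exact hfind 0 (by rw [tp, e1]; rfl) (by rw [tq, e2]; rfl) (by rw [tr, e3]; rfl) |
          exact hfind 1 (by rw [tp, e1]; rfl) (by rw [tq, e2]; rfl) (by rw [tr, e3]; rfl) |
          exact hfind 2 (by rw [tp, e1]; rfl) (by rw [tq, e2]; rfl) (by rw [tr, e3]; rfl) |
          exact hfind 3 (by rw [tp, e1]; rfl) (by rw [tq, e2]; rfl) (by rw [tr, e3]; rfl) |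
          exact hfind 4 (by rw [tp, e1]; rfl) (by rw [tq, e2]; rfl) (by rw [tr, e3]; rfl) |
          exact hfind 5 (by rw [tp, e1]; rfl) (by rw [tq, e2]; rfl) (by rw [tr, e3]; rfl)
    · rintro ⟨t, rfl⟩
      exact toff t
  exact ⟨v, tp, tq, tr, toff, hlab, hrange⟩

theorem isHexagonFace_of {n : ℕ} {J : Finset (Fin n)} {c : Fin n → ℝ} {x : Equiv.Perm (Fin n)}
    {p q r : Fin n} (h1 : x p < x q) (h2 : x q < x r)
    (hV : ∀ z, z ∈ maximizers J c ↔ ∀ s, s ≠ p → s ≠ q → s ≠ r → z s = x s) :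
    IsHexagonFace J (convexHull ℝ (permPoint '' maximizers J c)) := by
  obtain ⟨i, hi⟩ : ∃ i, x p = i := ⟨_, rfl⟩
  obtain ⟨j, hj⟩ : ∃ j, x q = j := ⟨_, rfl⟩
  obtain ⟨k, hk⟩ : ∃ k, x r = k := ⟨_, rfl⟩
  rw [hi, hj] at h1
  rw [hj, hk] at h2
  have nij := h1.ne
  have njk := h2.ne
  have nik := (h1.trans h2).ne
  have hpq : p ≠ q := by rintro rfl; exact nij (hi.symm.trans hj)
  have hpr : p ≠ r := by rintro rfl; exact nik (hi.symm.trans hk)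
  have hqr : q ≠ r := by rintro rfl; exact njk (hj.symm.trans hk)
  obtain ⟨v, tp, tq, tr, toff, hlab, hrange'⟩ := exists_hexagon_vertices hi hj hk nij njk nik
  have hrange : maximizers J c = Set.range v := Set.ext fun z => (hV z).trans (hrange' z)
  have c6 : ∀ t : Fin 6, t = 0 ∨ t = 1 ∨ t = 2 ∨ t = 3 ∨ t = 4 ∨ t = 5 := by decide
  have hij := val_lt h1
  have hjk := val_lt h2
  refine ⟨i, j, k, v, h1, h2, isLabelledPolygon_of hrange ?_ ?_ hlab ?_ ?_, ?_⟩
  · intro t u htu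
    have hp : ![i, j, k, k, j, i] t = ![i, j, k, k, j, i] u := by rw [← tp, ← tp, htu]
    have hq : ![j, i, i, j, k, k] t = ![j, i, i, j, k, k] u := by rw [← tq, ← tq, htu]
    rcases c6 t with rfl | rfl | rfl | rfl | rfl | rfl <;>
      rcases c6 u with rfl | rfl | rfl | rfl | rfl | rfl <;>
      first | rfl | exact absurd hp nij | exact absurd hp nij.symm | exact absurd hp nik |
        exact absurd hp nik.symm | exact absurd hp njk | exact absurd hp njk.symm |
        exact absurd hq nij | exact absurd hq nij.symm | exact absurd hq nik |
        exact absurd hq nik.symm | exact absurd hq njk | exact absurd hq njk.symm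
  · intro t
    rcases c6 t with rfl | rfl | rfl | rfl | rfl | rfl
    exacts [nij, njk, nij, njk, nij, njk]
  · intro t
    rcases c6 t with rfl | rfl | rfl | rfl | rfl | rfl
    · refine ⟨r, 1, by rw [tr, tr]; rfl, fun u hu hu' => ?_⟩
      rw [tr, tr]
      rcases c6 u with rfl | rfl | rfl | rfl | rfl | rfl <;> simp at hu hu' ⊢ <;> order
    · refine ⟨q, -1, by rw [tq, tq]; rfl, fun u hu hu' => ?_⟩
      rw [tq, tq]
      rcases c6 u with rfl | rfl | rfl | rfl | rfl | rfl <;> simp at hu hu' ⊢ <;> order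
    · refine ⟨p, 1, by rw [tp, tp]; rfl, fun u hu hu' => ?_⟩
      rw [tp, tp]
      rcases c6 u with rfl | rfl | rfl | rfl | rfl | rfl <;> simp at hu hu' ⊢ <;> order
    · refine ⟨r, -1, by rw [tr, tr]; rfl, fun u hu hu' => ?_⟩
      rw [tr, tr]
      rcases c6 u with rfl | rfl | rfl | rfl | rfl | rfl <;> simp at hu hu' ⊢ <;> order
    · refine ⟨q, 1, by rw [tq, tq]; rfl, fun u hu hu' => ?_⟩
      rw [tq, tq]
      rcases c6 u with rfl | rfl | rfl | rfl | rfl | rfl <;> simp at hu hu' ⊢ <;> order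
    · refine ⟨p, -1, by rw [tp, tp]; rfl, fun u hu hu' => ?_⟩
      rw [tp, tp]
      rcases c6 u with rfl | rfl | rfl | rfl | rfl | rfl <;> simp at hu hu' ⊢ <;> order
  · intro t u c₂ a b hab hsw heq hlt
    have h3' := fun hp hq hr => false_of_three_ne hsw hpq hpr hqr hp hq hr
    have hvne : v u ≠ v t := by
      intro h
      rw [hsw] at h
      exact hab (Equiv.swap_eq_one_iff.1 (mul_eq_left.1 h))
    rw [tp, tp, tq, tq, tr, tr] at h3'
    -- Vertices two steps apart differ by a 3-cycle, at all of `p`, `q` and `r`. Opposite vertices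
    -- do differ by a transposition and need the separate argument.
    have hfar : u = t + 1 ∨ t = u + 1 ∨ u = t + 3 := by
      rcases c6 t with rfl | rfl | rfl | rfl | rfl | rfl <;>
        rcases c6 u with rfl | rfl | rfl | rfl | rfl | rfl <;>
        first | exact Or.inl rfl | exact Or.inr (Or.inl rfl) | exact Or.inr (Or.inr rfl) |
          exact absurd rfl hvne |
          (exfalso; refine h3' ?_ ?_ ?_ <;> simp [nij, nij.symm, njk, njk.symm, nik, nik.symm])
    rcases hfar with h | h | rfl
    · exact Or.inl h
    · exact Or.inr h
    · exact (hexagon_false_of_opposite hpq hpr hqr h1 h2 hi hj hk tp tq tr toff heq hlt).elim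
  · intro t
    have hj : (i < j ∧ j < k) ∨ (k < j ∧ j < i) := Or.inl ⟨h1, h2⟩
    have odd : ∀ t, v t = Equiv.swap i j * v (t - 1) → v (t + 1) = Equiv.swap j k * v t →
        angleAt v t = 2 * Real.pi / 3 := fun t e1 e2 => by
      rw [angleAt_eq t (by rw [Equiv.swap_comm]; exact e1) e2]
      exact angle_permPoint_of_neg _ hj
    have even : ∀ t, v t = Equiv.swap j k * v (t - 1) → v (t + 1) = Equiv.swap i j * v t →
        angleAt v t = 2 * Real.pi / 3 := fun t e1 e2 => by
      rw [angleAt_eq t e1 (d := j) (e := i) (by rw [Equiv.swap_comm]; exact e2)]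
      exact angle_permPoint_of_neg _ hj.symm
    rcases c6 t with rfl | rfl | rfl | rfl | rfl | rfl
    exacts [even 0 (hlab 5) (hlab 0), odd 1 (hlab 0) (hlab 1), even 2 (hlab 1) (hlab 2),
      odd 3 (hlab 2) (hlab 3), even 4 (hlab 3) (hlab 4), odd 5 (hlab 4) (hlab 5)]

theorem mainTheorem2 {n : ℕ} (J : Finset (Fin n)) (F : Set (EuclideanSpace ℝ (Fin n)))
    (hF : IsFaceOfDim 2 (bridgePolytope J) F) :
    IsSquareFace J F ∨ IsTrapezoidFace J F ∨ IsHexagonFace J F := by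
  obtain ⟨c, rfl, hd⟩ := isFaceOfDim_iff.1 hF
  rcases classify_maximizers hd with ⟨x, p, q, r, s, h1, h2, h3, hV⟩ | ⟨x, p, q, r, h, hV⟩ |
    ⟨x, p, q, r, h1, h2, hV⟩
  · exact Or.inl (isSquareFace_of h1 h2 h3 hV)
  · exact Or.inr (Or.inl (isTrapezoidFace_of h hV))
  · exact Or.inr (Or.inr (isHexagonFace_of h1 h2 hV))
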